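/- Let $V$ be a finite-dimensional real vector space with a pseudo-Euclidean inner product $\langle\cdot,\cdot\rangle$ (a non-degenerate symmetric bilinear form), let $U\subseteq V$ be an open neighborhood of the origin which is star-shaped with respect to $0$, and let $g$ be a smooth pseudo-Riemannian metric on $U$ with $g(0)=\langle\cdot,\cdot\rangle$ which is given in normal coordinates, i.e. for every $\xi\in U$ the straight line $t\mapsto t\xi$, $t\in[0,1]$, is a geodesic. Let $\nabla$ be the Levi-Civita connection and $R(x,y,z,w)=g(\nabla_x\nabla_yz-\nabla_y\nabla_xz-\nabla_{[x,y]}z,w)$ the curvature tensor of $g$. For $k\ge 0$ define the endomorphism-valued homogeneous polynomial function $\mathcal R^{k)}:V\to\mathrm{End}(V)$ of degree $k+2$ by $\langle\mathcal R^{k)}(\xi)x,y\rangle=(\nabla^{k)}_{\xi,\dots,\xi}R)(x,\xi,\xi,y)$, where $\nabla^{k)}R$ is the $k$-fold iterated covariant derivative of $R$ at the origin. Let $\mathbb R\langle X_2,X_3,\dots\rangle$ be the free associative unital real algebra in the variables $X_2,X_3,\dots$, graded by $\deg X_i=i$, and define $\tilde Q_k$ in it by $\tilde Q_0:=1$ and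 $$\tilde Q_k:=-\frac{1}{k(k+1)}\sum_{\ell=2}^{k}\binom{k}{\ell}(\ell-1)\,\ell\,X_\ell\,\tilde Q_{k-\ell}\qquad(k\ge1).$$ Let $\tilde Q_k(\mathcal R^{0)},\mathcal R^{1)},\dots)$ denote the $\mathrm{End}(V)$-valued polynomial function obtained from $\tilde Q_k$ by substituting $X_{\ell+2}=\mathcal R^{\ell)}$ (products are pointwise compositions of endomorphisms). For $\xi\in U$ let $\Phi^{-1}(\xi)$ be the parallel transport from $T_\xi U\cong V$ back to $T_0U\cong V$ along the straight line $t\mapsto t\xi$. Then $\Phi^{-1}$ is a well-defined map $U\to\mathrm{GL}(V)$, each $\tilde Q_k$ is homogeneous of degree $k$, and $\Phi^{-1}$ has the asymptotic expansion $$\Phi^{-1}\sim\sum_{k=0}^{\infty}\frac1{k!}\,\tilde Q_k(\mathcal R^{0)},\mathcal R^{1)},\dots)$$ at the origin, that is, for every $N\ge0$, $$\Phi^{-1}(\xi)-\sum_{k=0}^{N}\frac1{k!}\,\tilde Q_k(\mathcal R^{0)},\mathcal R^{1)},\dots)(\xi)=O(\|\xi\|^{N+1})\qquad(\xi\to0).$$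 -/

import Mathlib

set_option maxSynthPendingDepth 3

open Set Filter Topology Asymptotics
open scoped ContDiff Nat

noncomputable section

namespace NormalCoord

/-! ### Metrics on subsets of a vector space and their Levi-Civita connection

`V` is a finite dimensional real vector space; its norm only serves to fix the topology (and, up to
equivalence, the size of vectors and endomorphisms). -/

section Geometry

variable {V : Type*} [NormedAddCommGroup V] [NormedSpace ℝ V]

/-- A pseudo-Euclidean inner product: a symmetric non-degenerate bilinear form. -/
structure IsPseudoEuclidean (b : V →L[ℝ] V →L[ℝ] ℝ) : Prop where
  symm : ∀ x y, b x y = b y x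
  nondegenerate : ∀ x, (∀ y, b x y = 0) → x = 0

/-- A smooth pseudo-Riemannian metric on the subset `U` of `V`. -/
structure IsPseudoRiemannianMetricOn (g : V → V →L[ℝ] V →L[ℝ] ℝ) (U : Set V) : Prop where
  smooth : ContDiffOn ℝ ∞ g U
  pseudoEuclidean : ∀ p ∈ U, IsPseudoEuclidean (g p)

/-- The Christoffel symbols of the first kind,
`(x, y, z) ↦ 1/2 * (D_x g (y, z) + D_y g (x, z) - D_z g (x, y))`. -/
def christoffelFirst (g : V → V →L[ℝ] V →L[ℝ] ℝ) (p : V) : V →L[ℝ] V →L[ℝ] V →L[ℝ] ℝ :=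
  let D : V →L[ℝ] V →L[ℝ] V →L[ℝ] ℝ := fderiv ℝ g p
  let E : V →L[ℝ] V →L[ℝ] V →L[ℝ] ℝ :=
    (ContinuousLinearMap.flipₗᵢ ℝ V V ℝ).toContinuousLinearEquiv.toContinuousLinearMap ∘L D.flip
  (1 / 2 : ℝ) • (D + D.flip - E)

theorem christoffelFirst_apply (g : V → V →L[ℝ] V →L[ℝ] ℝ) (p x y z : V) :
    christoffelFirst g p x y z =
      1 / 2 * (fderiv ℝ g p x y z + fderiv ℝ g p y x z - fderiv ℝ g p z x y) := rfl

/-- The Christoffel symbols `Γ_p(x, y)` of the Levi-Civita connection, obtained from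
`g_p(Γ_p(x, y), z) = christoffelFirst g p x y z` by inverting `g_p : V → V*`. -/
def christoffel (g : V → V →L[ℝ] V →L[ℝ] ℝ) (p : V) : V →L[ℝ] V →L[ℝ] V :=
  ContinuousLinearMap.compL ℝ V (V →L[ℝ] ℝ) V (g p).inverse ∘L christoffelFirst g p

theorem christoffel_apply (g : V → V →L[ℝ] V →L[ℝ] ℝ) (p x y : V) :
    christoffel g p x y = (g p).inverse (christoffelFirst g p x y) := rfl

/-- The covariant derivative `∇_X Y` of vector fields. -/
def covDeriv (g : V → V →L[ℝ] V →L[ℝ] ℝ) (X Y : V → V) (p : V) : V :=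
  fderiv ℝ Y p (X p) + christoffel g p (X p) (Y p)

/-- The curvature operator `R(x, y) z = ∇_x ∇_y z - ∇_y ∇_x z` of the Levi-Civita connection for
constant vector fields `x, y, z` (whose Lie brackets vanish), written out as
`(D_x Γ)(y, z) - (D_y Γ)(x, z) + Γ(x, Γ(y, z)) - Γ(y, Γ(x, z))`. -/
def curvatureOp (g : V → V →L[ℝ] V →L[ℝ] ℝ) (p : V) (x y : V) : V →L[ℝ] V :=
  fderiv ℝ (christoffel g) p x y - fderiv ℝ (christoffel g) p y x +
    christoffel g p x ∘L christoffel g p y - christoffel g p y ∘L christoffel g p x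

theorem curvatureOp_eq_covDeriv (g : V → V →L[ℝ] V →L[ℝ] ℝ) (p : V)
    (hg : DifferentiableAt ℝ (christoffel g) p) (x y z : V) :
    curvatureOp g p x y z =
      covDeriv g (fun _ => x) (covDeriv g (fun _ => y) (fun _ => z)) p -
      covDeriv g (fun _ => y) (covDeriv g (fun _ => x) (fun _ => z)) p := by
  have key : ∀ u v : V, fderiv ℝ (fun q => christoffel g q v z) p u =
      fderiv ℝ (christoffel g) p u v z := by
    intro u v
    have h := (hg.hasFDerivAt.clm_apply (hasFDerivAt_const v p)).clm_apply (hasFDerivAt_const z p)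
    rw [h.fderiv]
    simp
  have e : ∀ v : V, covDeriv g (fun _ => v) (fun _ => z) = fun q => christoffel g q v z := by
    intro v
    funext q
    simp [covDeriv]
  rw [e, e]
  simp only [covDeriv, key, curvatureOp]
  simp
  abel

/-- The curvature tensor `R(x, y, z, w) = g(R(x, y) z, w)` as a covariant 4-tensor field. -/
def curvatureTensor (g : V → V →L[ℝ] V →L[ℝ] ℝ) (p : V) : V [×4]→L[ℝ] ℝ where
  toFun v := g p (curvatureOp g p (v 0) (v 1) (v 2)) (v 3)
  map_update_add' := by
    intro inst v i a b
    obtain rfl : inst = instDecidableEqFin 4 := Subsingleton.elim _ _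
    fin_cases i <;> simp [Function.update, curvatureOp] <;> ring
  map_update_smul' := by
    intro inst v i c a
    obtain rfl : inst = instDecidableEqFin 4 := Subsingleton.elim _ _
    fin_cases i <;> simp [Function.update, curvatureOp] <;> ring
  cont := by
    simp only [curvatureOp]
    fun_prop

/-- The action `A ↦ ((v₁, …, vₙ) ↦ ∑ i, T (v₁, …, A vᵢ, …, vₙ))` of endomorphisms on a covariant
tensor `T`. -/
def endAction {n : ℕ} (T : V [×n]→L[ℝ] ℝ) : (V →L[ℝ] V) →L[ℝ] (V [×n]→L[ℝ] ℝ) :=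
  ((ContinuousMultilinearMap.compContinuousLinearMapContinuousMultilinear ℝ
    (fun _ : Fin n => V) (fun _ : Fin n => V) ℝ).linearDeriv
      (fun _ => ContinuousLinearMap.id ℝ V)).flip T ∘L
    ContinuousLinearMap.pi (fun _ => ContinuousLinearMap.id ℝ (V →L[ℝ] V))

theorem endAction_apply {n : ℕ} (T : V [×n]→L[ℝ] ℝ) (A : V →L[ℝ] V) (v : Fin n → V) :
    endAction T A v = ∑ i, T (Function.update v i (A (v i))) := by
  simp only [endAction, ContinuousLinearMap.comp_apply, ContinuousLinearMap.flip_apply,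
    ContinuousMultilinearMap.linearDeriv_apply, sum_apply]
  refine Finset.sum_congr rfl fun i _ => ?_
  change T _ = T _
  congr 1
  funext j
  by_cases h : j = i
  · subst h
    simp
  · simp [h]

/-- The covariant derivative of a covariant `n`-tensor field; the new slot comes first:
`(∇T)(x, v₁, …, vₙ) = D_x (T (v₁, …, vₙ)) - ∑ i, T (v₁, …, Γ(x, vᵢ), …, vₙ)`. -/
def nabla (g : V → V →L[ℝ] V →L[ℝ] ℝ) {n : ℕ} (T : V → (V [×n]→L[ℝ] ℝ)) (p : V) :
    V [×(n + 1)]→L[ℝ] ℝ :=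
  (fderiv ℝ T p - endAction (T p) ∘L christoffel g p).uncurryLeft

theorem nabla_apply (g : V → V →L[ℝ] V →L[ℝ] ℝ) {n : ℕ} (T : V → (V [×n]→L[ℝ] ℝ)) (p x : V)
    (v : Fin n → V) :
    nabla g T p (Fin.cons x v) =
      fderiv ℝ T p x v - ∑ i, T p (Function.update v i (christoffel g p x (v i))) := by
  simp [nabla, endAction_apply]

/-- The iterated covariant derivative `∇^k R` of the curvature tensor; the `k` differentiation slots
come first. -/
def nablaCurvature (g : V → V →L[ℝ] V →L[ℝ] ℝ) : (k : ℕ) → V → (V [×(4 + k)]→L[ℝ] ℝ)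
  | 0 => curvatureTensor g
  | k + 1 => nabla g (nablaCurvature g k)

/-- Insertion of `ξ` into the first `k` slots of a tensor. -/
def insertFirst (ξ : V) : (k : ℕ) → (V [×(4 + k)]→L[ℝ] ℝ) → (V [×4]→L[ℝ] ℝ)
  | 0, T => T
  | k + 1, T => insertFirst ξ k (ContinuousMultilinearMap.curryLeft (n := 4 + k) T ξ)

/-- The symmetrized `k`-th covariant derivative of the curvature tensor at the origin,
`𝓡^k(ξ; x, y) = ∇^k_{ξ, …, ξ} R (x, ξ, ξ, y)`. -/
def symCurvature (g : V → V →L[ℝ] V →L[ℝ] ℝ) (k : ℕ) (ξ x y : V) : ℝ :=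
  insertFirst ξ k (nablaCurvature g k 0) ![x, ξ, ξ, y]

/-- `symCurvature g k ξ` as a bilinear form in the last two arguments. -/
def symCurvatureForm [FiniteDimensional ℝ V] (g : V → V →L[ℝ] V →L[ℝ] ℝ) (k : ℕ) (ξ : V) :
    V →L[ℝ] V →L[ℝ] ℝ :=
  LinearMap.toContinuousLinearMap
    ((LinearMap.toContinuousLinearMap : (V →ₗ[ℝ] ℝ) ≃ₗ[ℝ] (V →L[ℝ] ℝ)).toLinearMap ∘ₗ
      LinearMap.mk₂ ℝ (symCurvature g k ξ)
        (fun x x' y => by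
          have e : ∀ u : V, Function.update ![0, ξ, ξ, y] (0 : Fin 4) u = ![u, ξ, ξ, y] := by
            intro u; funext j; fin_cases j <;> rfl
          simpa only [symCurvature, e, smul_eq_mul] using
            (insertFirst ξ k (nablaCurvature g k 0)).map_update_add ![0, ξ, ξ, y] 0 x x')
        (fun c x y => by
          have e : ∀ u : V, Function.update ![0, ξ, ξ, y] (0 : Fin 4) u = ![u, ξ, ξ, y] := by
            intro u; funext j; fin_cases j <;> rfl
          simpa only [symCurvature, e, smul_eq_mul] using
            (insertFirst ξ k (nablaCurvature g k 0)).map_update_smul ![0, ξ, ξ, y] 0 c x)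
        (fun x y y' => by
          have e : ∀ u : V, Function.update ![x, ξ, ξ, 0] (3 : Fin 4) u = ![x, ξ, ξ, u] := by
            intro u; funext j; fin_cases j <;> rfl
          simpa [symCurvature, e] using
            (insertFirst ξ k (nablaCurvature g k 0)).map_update_add ![x, ξ, ξ, 0] 3 y y')
        (fun c x y => by
          have e : ∀ u : V, Function.update ![x, ξ, ξ, 0] (3 : Fin 4) u = ![x, ξ, ξ, u] := by
            intro u; funext j; fin_cases j <;> rfl
          simpa [symCurvature, e] using
            (insertFirst ξ k (nablaCurvature g k 0)).map_update_smul ![x, ξ, ξ, 0] 3 c y))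

theorem symCurvatureForm_apply [FiniteDimensional ℝ V] (g : V → V →L[ℝ] V →L[ℝ] ℝ) (k : ℕ)
    (ξ x y : V) : symCurvatureForm g k ξ x y = symCurvature g k ξ x y := rfl

/-- The endomorphism valued polynomial function `𝓡^k` with
`b(𝓡^k(ξ) x, y) = 𝓡^k(ξ; x, y)`, where `b` is the inner product of `V`. -/
def symCurvatureOp [FiniteDimensional ℝ V] (b : V →L[ℝ] V →L[ℝ] ℝ)
    (g : V → V →L[ℝ] V →L[ℝ] ℝ) (k : ℕ) (ξ : V) : V →L[ℝ] V :=
  b.inverse ∘L symCurvatureForm g k ξ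

/-! ### Parallel transport and normal coordinates -/

/-- `Y` is a parallel vector field along the curve `γ` on the set `s` of parameters:
`Y' + Γ_γ(γ', Y) = 0`. -/
def IsParallelAlong (g : V → V →L[ℝ] V →L[ℝ] ℝ) (γ Y : ℝ → V) (s : Set ℝ) : Prop :=
  ∀ t ∈ s, HasDerivWithinAt Y (-christoffel g (γ t) (deriv γ t) (Y t)) s t

/-- A smooth curve `γ` is a geodesic on `s` if its velocity is parallel along `γ`. -/
def IsGeodesicOn (g : V → V →L[ℝ] V →L[ℝ] ℝ) (γ : ℝ → V) (s : Set ℝ) : Prop :=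
  ContDiff ℝ ∞ γ ∧ IsParallelAlong g γ (deriv γ) s

/-- The metric `g` on `U` is given in normal coordinates: all straight lines `t ↦ t ξ` with
`ξ ∈ U`, `t ∈ [0, 1]`, are geodesics. -/
def IsNormal (g : V → V →L[ℝ] V →L[ℝ] ℝ) (U : Set V) : Prop :=
  ∀ ξ ∈ U, IsGeodesicOn g (fun t => t • ξ) (Icc 0 1)

/-- `A` is the parallel transport from `ξ` back to the origin along `t ↦ t ξ`: every vector at `ξ`
is the value at time `1` of a parallel field along this line, and `A` sends the value at time `1` of
any such field to its value at time `0`. -/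
def IsBackwardsParallelTransport (g : V → V →L[ℝ] V →L[ℝ] ℝ) (ξ : V) (A : V →L[ℝ] V) : Prop :=
  (∀ v : V, ∃ Y : ℝ → V, IsParallelAlong g (fun t => t • ξ) Y (Icc 0 1) ∧ Y 1 = v) ∧
  ∀ Y : ℝ → V, IsParallelAlong g (fun t => t • ξ) Y (Icc 0 1) → A (Y 1) = Y 0

open Classical in
/-- The backwards parallel transport `Φ⁻¹`. -/
def backwardsParallelTransport (g : V → V →L[ℝ] V →L[ℝ] ℝ) (ξ : V) : V →L[ℝ] V :=
  if h : ∃ A, IsBackwardsParallelTransport g ξ A then h.choose else 0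

end Geometry

/-! ### The universal expressions -/

/-- The free associative algebra in the variables `X_2, X_3, …`. -/
abbrev FreeAlg : Type := FreeAlgebra ℝ {n : ℕ // 2 ≤ n}

/-- Homogeneous elements of degree `d`, where `X_i` has degree `i`. -/
def IsHomogeneousOfDegree (d : ℕ) (Q : FreeAlg) : Prop :=
  Q ∈ Submodule.span ℝ {M : FreeAlg | ∃ I : List {n : ℕ // 2 ≤ n},
    (I.map Subtype.val).sum = d ∧ M = (I.map (FreeAlgebra.ι ℝ)).prod}

/-- The recursion `Q̃_0 = 1` and
`Q̃_k = -1/(k(k+1)) ∑_{ℓ=2}^k binom(k, ℓ) (ℓ-1) ℓ X_ℓ Q̃_{k-ℓ}` for `k ≥ 1`. -/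
def Qtilde : ℕ → FreeAlg
  | 0 => 1
  | n + 1 =>
    let k : ℕ := n + 1
    (-(1 / ((k : ℝ) * ((k : ℝ) + 1)))) • ∑ l ∈ (Finset.Icc 2 k).attach,
      ((k.choose l.1 : ℝ) * ((l.1 : ℝ) - 1) * (l.1 : ℝ)) •
        (FreeAlgebra.ι ℝ ⟨l.1, (Finset.mem_Icc.mp l.2).1⟩ * Qtilde (k - l.1))
  decreasing_by
    have := Finset.mem_Icc.mp l.2
    omega

/-- Substitution `X_{ℓ+2} = A_ℓ` for a sequence of endomorphism valued functions on `V`, which are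
multiplied pointwise. -/
def substitute {V : Type*} [NormedAddCommGroup V] [NormedSpace ℝ V] (A : ℕ → V → V →L[ℝ] V) :
    FreeAlg →ₐ[ℝ] (V → V →L[ℝ] V) :=
  FreeAlgebra.lift ℝ fun i => A (i.1 - 2)

end NormalCoord

end

noncomputable section

namespace NormalCoord

/-! ### Global solvability of linear differential equations on the unit interval -/

section LinearODE

variable {E : Type*} [NormedAddCommGroup E] [NormedSpace ℝ E]

/-! Fix `ξ ∈ U` and let `P t` be the parallel transport from `t • ξ` back to the origin. In normal
coordinates the rays through the origin are geodesics, so `t ↦ t • v` is the variation field of a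
family of geodesics, hence a Jacobi field along `t ↦ t • ξ`. Transported to the origin, this says
that `A t = t • P t` solves the linear equation `A'' = -K A` with `A 0 = 0` and `A' 0 = 1`, where
`K` is the Jacobi operator `v ↦ R(v, ξ) ξ` conjugated by parallel transport. The value wanted is `A
1 = P 1`.

Since `ξ` is parallel along its own ray and parallel transport is isometric, the `j`-th derivative
of `K` is the transported `j`-th covariant derivative of the curvature; at `t = 0` it is `𝓡^j(ξ)`.
Leibniz' rule applied to `A'' = -K A` then expresses every derivative of `A` through `A`, `A'` and
the derivatives of `K` (`jacobiJet`). At `t = 0` this recursion, rescaled by `A^(k+1)(0) = (k+1)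
Q̃_k`, is the one defining `Q̃_k` (`jacobiJet_succ_eq_lift_Qtilde`), so the Taylor coefficient of
order `k + 1` of `A` is `Q̃_k / k!`.

The remainder is controlled by `A^(N+2)` on `[0, 1]`. The `j`-th derivative of `K` is of size
`‖ξ‖^(j+2)`, and the recursion turns this into a bound by a multiple of `‖ξ‖^(N+1)`
(`exists_norm_jacobiJet_le`), uniformly for `ξ` near the origin. Taylor's inequality at `t = 1`
finishes the proof. -/

theorem hasDerivWithinAt_Icc_glue {Y Z : ℝ → E} {f : ℝ → E → E} {a b c : ℝ} (hab : a ≤ b)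
    (hbc : b ≤ c) (hYZ : Z b = Y b)
    (hY : ∀ t ∈ Icc a b, HasDerivWithinAt Y (f t (Y t)) (Icc a b) t)
    (hZ : ∀ t ∈ Icc b c, HasDerivWithinAt Z (f t (Z t)) (Icc b c) t) :
    ∃ W : ℝ → E, W a = Y a ∧ ∀ t ∈ Icc a c, HasDerivWithinAt W (f t (W t)) (Icc a c) t := by
  classical
  let W : ℝ → E := fun t => if t ≤ b then Y t else Z t
  have hWY : ∀ t, t ≤ b → W t = Y t := fun t ht => if_pos ht
  have hWZ : ∀ t, b ≤ t → W t = Z t := by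
    intro t ht
    rcases ht.eq_or_lt with rfl | h
    · rw [hWY _ le_rfl, hYZ]
    · exact if_neg (not_le.mpr h)
  refine ⟨W, hWY a hab, fun t ht => ?_⟩
  rw [← Icc_union_Icc_eq_Icc hab hbc]
  have left : t ≤ b → HasDerivWithinAt W (f t (W t)) (Icc a b) t := fun h => by
    rw [hWY t h]
    exact (hY t ⟨ht.1, h⟩).congr (fun s hs => hWY s hs.2) (hWY t h)
  have right : b ≤ t → HasDerivWithinAt W (f t (W t)) (Icc b c) t := fun h => by
    rw [hWZ t h]
    exact (hZ t ⟨h, ht.2⟩).congr (fun s hs => hWZ s hs.1) (hWZ t h)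
  refine HasDerivWithinAt.union ?_ ?_
  · rcases le_or_gt t b with h | h
    · exact left h
    · exact HasFDerivWithinAt.of_notMem_closure
        (by rw [isClosed_Icc.closure_eq]; exact fun h' => h.not_ge h'.2)
  · rcases le_or_gt b t with h | h
    · exact right h
    · exact HasFDerivWithinAt.of_notMem_closure
        (by rw [isClosed_Icc.closure_eq]; exact fun h' => h.not_ge h'.1)

variable [CompleteSpace E]

/-- The length of the interval depends on neither the initial time nor the initial value, so
finitely many such solutions can be glued to cover `[0, 1]`. -/
theorem exists_linearODE_solution_of_short {A : ℝ → E →L[ℝ] E} (hA : Continuous A) {M : ℝ}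
    (hM : 0 < M) (hAM : ∀ t, ‖A t‖ ≤ M) (s : ℝ) (x₀ : E) :
    ∃ Z : ℝ → E, Z s = x₀ ∧ ∀ t ∈ Icc s (s + 1 / (2 * M)),
      HasDerivWithinAt Z (A t (Z t)) (Icc s (s + 1 / (2 * M))) t := by
  have hh : 0 < 1 / (2 * M) := by positivity
  -- On the ball of radius `‖x₀‖` about `x₀` the speed is at most `2 * M * ‖x₀‖`, so the solution
  -- cannot leave the ball before time `1 / (2 * M)`; `‖x₀‖` cancels.
  have hpl : IsPicardLindelof (fun t x => A t x) (tmin := s) (tmax := s + 1 / (2 * M))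
      ⟨s, le_rfl, by linarith⟩ x₀ ‖x₀‖₊ 0 (2 * M.toNNReal * ‖x₀‖₊) M.toNNReal := by
    refine ⟨fun t _ => ?_, fun x _ => ?_, fun t _ x hx => ?_, ?_⟩
    · refine ((A t).lipschitz.weaken ?_).lipschitzOnWith
      rw [← NNReal.coe_le_coe]
      simpa [hM.le] using hAM t
    · exact (hA.clm_apply continuous_const).continuousOn
    · have h1 : ‖x‖ ≤ 2 * ‖x₀‖ := by
        have h2 : ‖x - x₀‖ ≤ ‖x₀‖ := by simpa [dist_eq_norm] using hx
        have h3 := norm_le_norm_add_norm_sub' x x₀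
        linarith
      calc ‖A t x‖ ≤ M * (2 * ‖x₀‖) :=
            ((A t).le_opNorm x).trans (mul_le_mul (hAM t) h1 (norm_nonneg _) hM.le)
        _ = _ := by simp [hM.le]; ring
    · have : max (s + 1 / (2 * M) - s) (s - s) = 1 / (2 * M) := by
        rw [add_sub_cancel_left, sub_self, max_eq_left hh.le]
      simp only [this]
      simp only [NNReal.coe_mul, Real.coe_toNNReal _ hM.le, coe_nnnorm, NNReal.coe_ofNat,
        NNReal.coe_zero, sub_zero]
      rw [mul_right_comm, mul_one_div_cancel (by positivity), one_mul]
  exact hpl.exists_eq_forall_mem_Icc_hasDerivWithinAt₀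

/-- Linear ordinary differential equations are solvable on the whole interval `[0, 1]`. -/
theorem exists_linearODE_solution {A : ℝ → E →L[ℝ] E} (hA : ContinuousOn A (Icc 0 1)) (x₀ : E) :
    ∃ Y : ℝ → E, Y 0 = x₀ ∧
      ∀ t ∈ Icc (0 : ℝ) 1, HasDerivWithinAt Y (A t (Y t)) (Icc 0 1) t := by
  -- Constant continuation beyond the endpoints keeps the bound and lets the last step overshoot
  -- `1`.
  let B : ℝ → E →L[ℝ] E := IccExtend zero_le_one ((Icc (0 : ℝ) 1).domRestrict A)
  have hB : Continuous B := hA.domRestrict.Icc_extend'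
  have hBA : ∀ t ∈ Icc (0 : ℝ) 1, B t = A t := fun t ht => IccExtend_of_mem _ _ ht
  obtain ⟨C, hC⟩ := isCompact_Icc.exists_bound_of_continuousOn hA
  set M : ℝ := max C 1
  have hM : 0 < M := lt_max_of_lt_right one_pos
  have hBM : ∀ t, ‖B t‖ ≤ M := fun t => (hC _ (projIcc (0 : ℝ) 1 zero_le_one t).2).trans
    (le_max_left _ _)
  have step : ∀ n : ℕ, ∃ Y : ℝ → E, Y 0 = x₀ ∧ ∀ t ∈ Icc (0 : ℝ) (n * (1 / (2 * M))),
      HasDerivWithinAt Y (B t (Y t)) (Icc (0 : ℝ) (n * (1 / (2 * M)))) t := by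
    intro n
    induction n with
    | zero =>
      refine ⟨fun _ => x₀, rfl, fun t ht => ?_⟩
      rw [Nat.cast_zero, zero_mul, Icc_self] at ht ⊢
      rw [mem_singleton_iff.mp ht]
      exact HasFDerivWithinAt.of_subsingleton subsingleton_singleton
    | succ n ih =>
      obtain ⟨Y, hY0, hY⟩ := ih
      obtain ⟨Z, hZ0, hZ⟩ := exists_linearODE_solution_of_short hB hM hBM
        (n * (1 / (2 * M))) (Y (n * (1 / (2 * M))))
      obtain ⟨W, hW0, hW⟩ := hasDerivWithinAt_Icc_glue (f := fun t x => B t x)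
        (by positivity) (by linarith [show 0 < 1 / (2 * M) by positivity]) hZ0 hY hZ
      refine ⟨W, hW0.trans hY0, ?_⟩
      rwa [Nat.cast_succ, add_one_mul]
  obtain ⟨n, hn⟩ := exists_nat_ge (2 * M)
  obtain ⟨Y, hY0, hY⟩ := step n
  have h1 : (1 : ℝ) ≤ n * (1 / (2 * M)) := by
    rw [mul_one_div, le_div_iff₀ (by positivity)]; linarith
  refine ⟨Y, hY0, fun t ht => ?_⟩
  rw [← hBA t ht]
  exact (hY t ⟨ht.1, ht.2.trans h1⟩).mono (Icc_subset_Icc_right h1)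

end LinearODE

/-! ### Gronwall and Taylor estimates on the unit interval -/

section Calculus

variable {E F : Type*} [NormedAddCommGroup E] [NormedSpace ℝ E] [NormedAddCommGroup F]
  [NormedSpace ℝ F]

theorem eq_of_hasDerivWithinAt_zero {f : ℝ → E}
    (h : ∀ t ∈ Icc (0 : ℝ) 1, HasDerivWithinAt f 0 (Icc 0 1) t) {t : ℝ} (ht : t ∈ Icc (0 : ℝ) 1) :
    f t = f 0 := by
  refine constant_of_has_deriv_right_zero (fun s hs => (h s hs).continuousWithinAt)
    (fun s hs => ?_) t ht
  exact (h s (Ico_subset_Icc_self hs)).mono_of_mem_nhdsWithin (Icc_mem_nhdsGE_of_mem hs)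

/-- Gronwall's inequality on `[0, 1]` for a linear growth bound with constant `1`. -/
theorem norm_le_of_hasDerivWithinAt_of_norm_le {f f' : ℝ → E} {C : ℝ}
    (h : ∀ t ∈ Icc (0 : ℝ) 1, HasDerivWithinAt f (f' t) (Icc 0 1) t)
    (hf' : ∀ t ∈ Icc (0 : ℝ) 1, ‖f' t‖ ≤ ‖f t‖) (h0 : ‖f 0‖ ≤ C) {t : ℝ}
    (ht : t ∈ Icc (0 : ℝ) 1) : ‖f t‖ ≤ C * Real.exp 1 := by
  have key := norm_le_gronwallBound_of_norm_deriv_right_le (δ := C) (K := 1) (ε := 0)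
    (fun s hs => (h s hs).continuousWithinAt)
    (fun s hs => (h s (Ico_subset_Icc_self hs)).mono_of_mem_nhdsWithin
      (Icc_mem_nhdsGE_of_mem hs)) h0
    (fun s hs => by simpa using hf' s (Ico_subset_Icc_self hs)) t ht
  rw [gronwallBound_ε0, one_mul, sub_zero] at key
  refine key.trans (mul_le_mul_of_nonneg_left (Real.exp_le_exp.mpr ht.2) ?_)
  exact (norm_nonneg _).trans h0

theorem hasDerivWithinAt_clm_of_apply [FiniteDimensional ℝ E] {f : ℝ → E →L[ℝ] F}
    {f' : E →L[ℝ] F} {s : Set ℝ} {t : ℝ}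
    (h : ∀ x, HasDerivWithinAt (fun r => f r x) (f' x) s t) : HasDerivWithinAt f f' s t := by
  let v := Module.finBasis ℝ E
  let e : (E →L[ℝ] F) ≃L[ℝ] (Fin (Module.finrank ℝ E) → F) :=
    (v.equivFunL.arrowCongr (1 : F ≃L[ℝ] F)).trans (ContinuousLinearEquiv.piRing _)
  have he : ∀ L i, e L i = L (v i) := by
    intro L i
    change L (v.equivFun.symm (Pi.single i 1)) = _
    simp
  have h1 : HasDerivWithinAt (fun r => e (f r)) (e f') s t :=
    hasDerivWithinAt_pi.mpr fun i => by simpa only [he] using h (v i)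
  simpa [Function.comp_def] using e.symm.hasFDerivAt.comp_hasDerivWithinAt t h1

/-- Taylor's inequality on `[0, 1]` for a function whose successive derivatives are `a 1, a 2, …`. -/
theorem norm_sub_taylor_le_of_hasDerivWithinAt {a : ℕ → ℝ → E}
    (h : ∀ n, ∀ t ∈ Icc (0 : ℝ) 1, HasDerivWithinAt (a n) (a (n + 1) t) (Icc 0 1) t) {n : ℕ}
    {C : ℝ} (hC : ∀ t ∈ Icc (0 : ℝ) 1, ‖a (n + 1) t‖ ≤ C) :
    ‖a 0 1 - ∑ k ∈ Finset.range (n + 1), (1 / (k ! : ℝ)) • a k 0‖ ≤ C := by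
  have hu : UniqueDiffOn ℝ (Icc (0 : ℝ) 1) := uniqueDiffOn_Icc one_pos
  -- Derivatives within `[0, 1]` are unique, so the given chain must consist of the iterated
  -- derivatives.
  have hiter : ∀ k, EqOn (iteratedDerivWithin k (a 0) (Icc 0 1)) (a k) (Icc 0 1) := by
    intro k
    induction k with
    | zero => intro t _; simp
    | succ k ih =>
      intro t ht
      rw [iteratedDerivWithin_succ, derivWithin_congr ih (ih ht)]
      exact (h k t ht).derivWithin (hu t ht)
  have hcont : ContDiffOn ℝ (n + 1) (a 0) (Icc 0 1) := by
    refine (contDiffOn_nat_iff_continuousOn_differentiableOn_deriv (n := n + 1) hu).mpr ⟨?_, ?_⟩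
    · exact fun k _ => ContinuousOn.congr (fun t ht => (h k t ht).continuousWithinAt) (hiter k)
    · exact fun k _ => DifferentiableOn.congr
        (fun t ht => (h k t ht).differentiableWithinAt) (hiter k)
  have h0 : (0 : ℝ) ∈ Icc (0 : ℝ) 1 := ⟨le_rfl, zero_le_one⟩
  have key := taylor_mean_remainder_bound (x := 1) zero_le_one hcont ⟨zero_le_one, le_rfl⟩
    (C := C) (fun t ht => by rw [hiter _ ht]; exact hC t ht)
  rw [taylor_within_apply] at key
  have hC0 : 0 ≤ C := (norm_nonneg _).trans (hC 0 h0)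
  calc _ = _ := by
        congr 2
        refine Finset.sum_congr rfl fun k _ => ?_
        rw [hiter k h0]
        simp
    _ ≤ _ := key
    _ ≤ C := by
        rw [sub_zero, one_pow, mul_one]
        exact div_le_self hC0 (by exact_mod_cast Nat.one_le_iff_ne_zero.mpr (Nat.factorial_ne_zero n))

end Calculus

/-! ### The Levi-Civita connection: symmetry, metric compatibility, smoothness -/

section Smoothness

variable {V : Type*} [NormedAddCommGroup V] [NormedSpace ℝ V]
  {g : V → V →L[ℝ] V →L[ℝ] ℝ} {U : Set V}

theorem fderiv_metric_symm (hU : IsOpen U) (hg : IsPseudoRiemannianMetricOn g U) {p : V}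
    (hp : p ∈ U) (x y z : V) : fderiv ℝ g p x y z = fderiv ℝ g p x z y := by
  have hd : DifferentiableAt ℝ g p :=
    (hg.smooth.contDiffAt (hU.mem_nhds hp)).differentiableAt (by simp)
  have key : ∀ u v : V, fderiv ℝ (fun q => g q u v) p x = fderiv ℝ g p x u v := by
    intro u v
    rw [((hd.hasFDerivAt.clm_apply (hasFDerivAt_const u p)).clm_apply
      (hasFDerivAt_const v p)).fderiv]
    simp
  rw [← key, ← key]
  congr 1
  refine Filter.EventuallyEq.fderiv_eq ?_
  filter_upwards [hU.mem_nhds hp] with q hq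
  exact (hg.pseudoEuclidean q hq).symm y z

theorem christoffel_symm (hU : IsOpen U) (hg : IsPseudoRiemannianMetricOn g U) {p : V}
    (hp : p ∈ U) (x y : V) : christoffel g p x y = christoffel g p y x := by
  rw [christoffel_apply, christoffel_apply]
  congr 1
  ext z
  rw [christoffelFirst_apply, christoffelFirst_apply, fderiv_metric_symm hU hg hp z x y]
  ring

variable [FiniteDimensional ℝ V]

theorem IsPseudoEuclidean.isInvertible {b : V →L[ℝ] V →L[ℝ] ℝ} (hb : IsPseudoEuclidean b) :
    b.IsInvertible := by
  have hinj : Function.Injective (b : V →ₗ[ℝ] (V →L[ℝ] ℝ)) := by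
    rw [injective_iff_map_eq_zero]
    intro x hx
    exact hb.nondegenerate x fun y => by
      have := congrArg (fun l : V →L[ℝ] ℝ => l y) hx
      simpa using this
  have hfin : Module.finrank ℝ V = Module.finrank ℝ (V →L[ℝ] ℝ) := by
    rw [← (LinearMap.toContinuousLinearMap : (V →ₗ[ℝ] ℝ) ≃ₗ[ℝ] (V →L[ℝ] ℝ)).finrank_eq]
    exact (Subspace.dual_finrank_eq (K := ℝ) (V := V)).symm
  exact ⟨(LinearEquiv.ofInjectiveOfFinrankEq _ hinj hfin).toContinuousLinearEquiv, by ext; rfl⟩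

theorem apply_christoffel (hg : IsPseudoRiemannianMetricOn g U) {p : V} (hp : p ∈ U) (x y z : V) :
    g p (christoffel g p x y) z = christoffelFirst g p x y z := by
  rw [christoffel_apply, (hg.pseudoEuclidean p hp).isInvertible.self_apply_inverse]

/-- Metric compatibility of the connection, which makes parallel transport isometric. -/
theorem fderiv_metric_apply (hU : IsOpen U) (hg : IsPseudoRiemannianMetricOn g U) {p : V}
    (hp : p ∈ U) (v x y : V) : fderiv ℝ g p v x y =
      g p (christoffel g p v x) y + g p x (christoffel g p v y) := by
  rw [(hg.pseudoEuclidean p hp).symm x, apply_christoffel hg hp, apply_christoffel hg hp,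
    christoffelFirst_apply, christoffelFirst_apply, fderiv_metric_symm hU hg hp v y x,
    fderiv_metric_symm hU hg hp x v y, fderiv_metric_symm hU hg hp y v x]
  ring

theorem contDiffOn_christoffel (hU : IsOpen U) (hg : IsPseudoRiemannianMetricOn g U) :
    ContDiffOn ℝ ∞ (christoffel g) U := by
  have h1 : ContDiffOn ℝ ∞ (fun p => (g p).inverse) U := fun p hp =>
    ((hg.pseudoEuclidean p hp).isInvertible.contDiffAt_map_inverse).comp_contDiffWithinAt p
      (hg.smooth p hp)
  have h2 : ContDiffOn ℝ ∞ (fderiv ℝ g) U := hg.smooth.fderiv_of_isOpen hU (by simp)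
  have h3 : ContDiffOn ℝ ∞ (christoffelFirst g) U := by
    have hflip : ContDiffOn ℝ ∞ (fun p => (fderiv ℝ g p).flip) U :=
      (ContinuousLinearMap.flipₗᵢ ℝ V V (V →L[ℝ] ℝ)).contDiff.comp_contDiffOn h2
    exact ContDiffOn.const_smul (1 / 2 : ℝ) ((h2.add hflip).sub (contDiffOn_const.clm_comp hflip))
  exact ((ContinuousLinearMap.compL ℝ V (V →L[ℝ] ℝ) V).contDiff.comp_contDiffOn h1).clm_comp h3

theorem contDiffOn_curvatureOp (hU : IsOpen U) (hg : IsPseudoRiemannianMetricOn g U) (x y : V) :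
    ContDiffOn ℝ ∞ (fun p => curvatureOp g p x y) U := by
  have h1 := contDiffOn_christoffel hU hg
  have h2 : ContDiffOn ℝ ∞ (fderiv ℝ (christoffel g)) U := h1.fderiv_of_isOpen hU (by simp)
  have hΓ : ∀ u, ContDiffOn ℝ ∞ (fun p => christoffel g p u) U := fun u =>
    h1.clm_apply contDiffOn_const
  have hD : ∀ u v, ContDiffOn ℝ ∞ (fun p => fderiv ℝ (christoffel g) p u v) U := fun u v =>
    (h2.clm_apply contDiffOn_const).clm_apply contDiffOn_const
  exact (((hD x y).sub (hD y x)).add ((hΓ x).clm_comp (hΓ y))).sub ((hΓ y).clm_comp (hΓ x))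

/-- A tensor is determined by its values on tuples of basis vectors, and a linear left inverse of
this evaluation map is continuous because its domain is finite-dimensional. -/
theorem contDiffOn_continuousMultilinearMap_of_apply {E : Type*} [NormedAddCommGroup E]
    [NormedSpace ℝ E] {n : ℕ} {f : E → V [×n]→L[ℝ] ℝ} {s : Set E} {m : WithTop ℕ∞}
    (h : ∀ v, ContDiffOn ℝ m (fun p => f p v) s) : ContDiffOn ℝ m f s := by
  have : FiniteDimensional ℝ (V [×n]→L[ℝ] ℝ) :=
    Module.Finite.of_injective
      (ContinuousMultilinearMap.toMultilinearMapLinear :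
        (V [×n]→L[ℝ] ℝ) →ₗ[ℝ] MultilinearMap ℝ (fun _ : Fin n => V) ℝ)
      ContinuousMultilinearMap.toMultilinearMap_injective
  let v := Module.finBasis ℝ V
  let e : (V [×n]→L[ℝ] ℝ) →ₗ[ℝ] ((Fin n → Fin (Module.finrank ℝ V)) → ℝ) :=
    { toFun := fun T i => T fun j => v (i j)
      map_add' := fun _ _ => rfl
      map_smul' := fun _ _ => rfl }
  have he : LinearMap.ker e = ⊥ := by
    rw [LinearMap.ker_eq_bot]
    intro S T hST
    refine ContinuousMultilinearMap.toMultilinearMap_injective ?_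
    exact Module.Basis.ext_multilinear (fun _ => v) fun i => congrFun hST i
  obtain ⟨k, hk⟩ := LinearMap.exists_leftInverse_of_injective e he
  have hf : f = fun p => LinearMap.toContinuousLinearMap k (e (f p)) := by
    funext p
    exact (LinearMap.congr_fun hk (f p)).symm
  rw [hf]
  refine (ContinuousLinearMap.contDiff _).comp_contDiffOn ?_
  exact contDiffOn_pi.mpr fun i => h _

theorem contDiffOn_curvatureTensor (hU : IsOpen U) (hg : IsPseudoRiemannianMetricOn g U) :
    ContDiffOn ℝ ∞ (curvatureTensor g) U :=
  contDiffOn_continuousMultilinearMap_of_apply fun v =>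
    (hg.smooth.clm_apply ((contDiffOn_curvatureOp hU hg (v 0) (v 1)).clm_apply
      contDiffOn_const)).clm_apply contDiffOn_const

theorem contDiffOn_nabla (hU : IsOpen U) (hg : IsPseudoRiemannianMetricOn g U) {n : ℕ}
    {T : V → V [×n]→L[ℝ] ℝ} (hT : ContDiffOn ℝ ∞ T U) : ContDiffOn ℝ ∞ (nabla g T) U := by
  have h1 : ContDiffOn ℝ ∞ (fderiv ℝ T) U := hT.fderiv_of_isOpen hU (by simp)
  have h2 : ContDiffOn ℝ ∞ (fun p => endAction (T p)) U := by
    unfold endAction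
    exact ((ContinuousLinearMap.contDiff _).comp_contDiffOn hT).clm_comp contDiffOn_const
  exact (continuousMultilinearCurryLeftEquiv ℝ (fun _ : Fin (n + 1) => V)
    ℝ).symm.contDiff.comp_contDiffOn (h1.sub (h2.clm_comp (contDiffOn_christoffel hU hg)))

theorem contDiffOn_nablaCurvature (hU : IsOpen U) (hg : IsPseudoRiemannianMetricOn g U) (k : ℕ) :
    ContDiffOn ℝ ∞ (nablaCurvature g k) U := by
  induction k with
  | zero => exact contDiffOn_curvatureTensor hU hg
  | succ k ih => exact contDiffOn_nabla hU hg ih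

end Smoothness

/-! ### Radial geodesics, Jacobi fields and parallel fields in normal coordinates -/

section Line

variable {V : Type*} [NormedAddCommGroup V] [NormedSpace ℝ V]
  {g : V → V →L[ℝ] V →L[ℝ] ℝ} {U : Set V}

theorem deriv_smul_line (ξ : V) : deriv (fun t : ℝ => t • ξ) = fun _ => ξ := by
  funext t
  simpa using ((hasDerivAt_id t).smul_const ξ).deriv

theorem hasDerivWithinAt_smul_line (ξ : V) (s : Set ℝ) (t : ℝ) :
    HasDerivWithinAt (fun t : ℝ => t • ξ) ξ s t := by
  simpa using ((hasDerivAt_id t).smul_const ξ).hasDerivWithinAt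

theorem isParallelAlong_line_iff {ξ : V} {Y : ℝ → V} {s : Set ℝ} :
    IsParallelAlong g (fun t => t • ξ) Y s ↔
      ∀ t ∈ s, HasDerivWithinAt Y (-christoffel g (t • ξ) ξ (Y t)) s t := by
  simp only [IsParallelAlong, deriv_smul_line]

theorem christoffel_radial (hnormal : IsNormal g U) {ξ : V} (hξ : ξ ∈ U) {t : ℝ}
    (ht : t ∈ Icc (0 : ℝ) 1) : christoffel g (t • ξ) ξ ξ = 0 := by
  have h := (hnormal ξ hξ).2
  rw [deriv_smul_line, isParallelAlong_line_iff] at h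
  have hu := uniqueDiffOn_Icc (zero_lt_one (α := ℝ)) t ht
  simpa using hu.eq_deriv _ (h t ht) (hasDerivWithinAt_const t _ ξ)

/-- The geodesic equation at `t = 0` kills the diagonal for vectors in `U`, homogeneity extends this
to all vectors, and symmetry allows polarization. -/
theorem christoffel_zero (hU : IsOpen U) (h0 : (0 : V) ∈ U)
    (hg : IsPseudoRiemannianMetricOn g U) (hnormal : IsNormal g U) (x y : V) :
    christoffel g 0 x y = 0 := by
  have hdiag : ∀ v, christoffel g 0 v v = 0 := by
    intro v
    have hc : Tendsto (fun c : ℝ => c • v) (𝓝[>] 0) (𝓝 0) := by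
      have : Continuous fun c : ℝ => c • v := by fun_prop
      simpa using (this.tendsto 0).mono_left nhdsWithin_le_nhds
    obtain ⟨c, hcU, hc0⟩ := ((hc.eventually (hU.mem_nhds h0)).and self_mem_nhdsWithin).exists
    have h := christoffel_radial hnormal hcU (t := 0) ⟨le_rfl, zero_le_one⟩
    rw [zero_smul] at h
    have hc0' : c ≠ 0 := ne_of_gt hc0
    simpa [hc0'] using h
  have h := hdiag (x + y)
  simp only [map_add, add_apply, hdiag, christoffel_symm hU hg h0 y x, zero_add, add_zero] at h
  have h2 : (2 : ℝ) • christoffel g 0 x y = 0 := by rw [two_smul]; exact h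
  simpa using h2

/-- The identity `Γ_q(q, q) = 0` holds on all of `U`, so it can be differentiated at `q = t • ξ` in
the non-radial direction `v`. Dividing by `t` is possible for `t > 0`; at `t = 0` both sides vanish.
-/
theorem smul_fderiv_christoffel_radial (hU : IsOpen U) (h0 : (0 : V) ∈ U)
    (hstar : StarConvex ℝ (0 : V) U) (hg : IsPseudoRiemannianMetricOn g U)
    (hnormal : IsNormal g U) {ξ : V} (hξ : ξ ∈ U) {t : ℝ} (ht : t ∈ Icc (0 : ℝ) 1)
    (hd : DifferentiableAt ℝ (christoffel g) (t • ξ)) (v : V) :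
    t • fderiv ℝ (christoffel g) (t • ξ) v ξ ξ = -(2 : ℝ) • christoffel g (t • ξ) ξ v := by
  rcases ht.1.eq_or_lt with rfl | htpos
  · simp [christoffel_zero hU h0 hg hnormal]
  have hmem : t • ξ ∈ U := hstar.smul_mem hξ ht.1 ht.2
  have h1 : HasFDerivAt (fun q => christoffel g q q q) (0 : V →L[ℝ] V) (t • ξ) := by
    refine (hasFDerivAt_const (0 : V) _).congr_of_eventuallyEq ?_
    filter_upwards [hU.mem_nhds hmem] with q hq
    simpa using christoffel_radial hnormal hq (t := 1) ⟨zero_le_one, le_rfl⟩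
  have h2 := (hd.hasFDerivAt.clm_apply (hasFDerivAt_id (t • ξ))).clm_apply
    (hasFDerivAt_id (t • ξ))
  have h3 := congrArg (fun L : V →L[ℝ] V => L v) (h1.unique h2)
  simp only [zero_apply, add_apply, ContinuousLinearMap.comp_apply,
    ContinuousLinearMap.flip_apply, ContinuousLinearMap.id_apply, id_eq, map_smul,
    smul_apply] at h3
  rw [christoffel_symm hU hg hmem v ξ] at h3
  have h4 : t • (t • fderiv ℝ (christoffel g) (t • ξ) v ξ ξ +
      (2 : ℝ) • christoffel g (t • ξ) ξ v) = 0 := by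
    rw [h3]
    module
  rw [neg_smul]
  exact eq_neg_of_add_eq_zero_left ((smul_eq_zero.mp h4).resolve_left htpos.ne')

/-- The vector fields `t ↦ t • v` are Jacobi fields along `t ↦ t • ξ`. -/
theorem jacobi_radial (hU : IsOpen U) (h0 : (0 : V) ∈ U)
    (hstar : StarConvex ℝ (0 : V) U) (hg : IsPseudoRiemannianMetricOn g U)
    (hnormal : IsNormal g U) {ξ : V} (hξ : ξ ∈ U) {t : ℝ} (ht : t ∈ Icc (0 : ℝ) 1)
    (hd : DifferentiableAt ℝ (christoffel g) (t • ξ)) (v : V) :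
    (2 : ℝ) • christoffel g (t • ξ) ξ v + t • fderiv ℝ (christoffel g) (t • ξ) ξ ξ v +
      t • christoffel g (t • ξ) ξ (christoffel g (t • ξ) ξ v) =
      -(t • curvatureOp g (t • ξ) v ξ ξ) := by
  have hmem : t • ξ ∈ U := hstar.smul_mem hξ ht.1 ht.2
  have hsymm : fderiv ℝ (christoffel g) (t • ξ) ξ v ξ = fderiv ℝ (christoffel g) (t • ξ) ξ ξ v := by
    have key : ∀ u w : V, fderiv ℝ (fun q => christoffel g q u w) (t • ξ) ξ =
        fderiv ℝ (christoffel g) (t • ξ) ξ u w := by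
      intro u w
      rw [((hd.hasFDerivAt.clm_apply (hasFDerivAt_const u _)).clm_apply
        (hasFDerivAt_const w _)).fderiv]
      simp
    rw [← key, ← key]
    congr 1
    refine Filter.EventuallyEq.fderiv_eq ?_
    filter_upwards [hU.mem_nhds hmem] with q hq
    exact christoffel_symm hU hg hq v ξ
  have h := smul_fderiv_christoffel_radial hU h0 hstar hg hnormal hξ ht hd v
  simp only [curvatureOp, sub_apply, add_apply, ContinuousLinearMap.comp_apply,
    christoffel_radial hnormal hξ ht, map_zero, hsymm, christoffel_symm hU hg hmem v ξ, smul_sub,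
    smul_add, h]
  module

/-- The derivative of a tensor field evaluated on parallel fields is its covariant derivative. -/
theorem hasDerivWithinAt_tensor_parallel {ξ : V} {n : ℕ} {T : V → V [×n]→L[ℝ] ℝ} {s : Set ℝ}
    {t : ℝ} (hT : DifferentiableAt ℝ T (t • ξ)) {W : ℝ → Fin n → V}
    (hW : ∀ i, HasDerivWithinAt (fun r => W r i) (-christoffel g (t • ξ) ξ (W t i)) s t) :
    HasDerivWithinAt (fun r => T (r • ξ) (W r)) (nabla g T (t • ξ) (Fin.cons ξ (W t))) s t := by
  have h1 := (hT.hasFDerivAt.comp_hasDerivWithinAt t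
    (hasDerivWithinAt_smul_line ξ s t)).hasFDerivWithinAt
  have h2 := (h1.continuousMultilinearMap_apply (g := fun i r => W r i)
    fun i => (hW i).hasFDerivWithinAt).hasDerivWithinAt
  refine h2.congr_deriv ?_
  rw [nabla_apply]
  simp [ContinuousMultilinearMap.toContinuousLinearMap, sub_eq_add_neg]

/-- The tuple `(ξ, …, ξ, v)` with `k` entries `ξ` in front. -/
def prependVector (ξ : V) {n : ℕ} (v : Fin n → V) : (k : ℕ) → Fin (n + k) → V
  | 0 => v
  | k + 1 => Fin.cons (α := fun _ => V) ξ (prependVector ξ v k)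

theorem insertFirst_apply (ξ : V) (k : ℕ) (T : V [×(4 + k)]→L[ℝ] ℝ) (v : Fin 4 → V) :
    insertFirst ξ k T v = T (prependVector ξ v k) := by
  induction k with
  | zero => rfl
  | succ k ih => exact ih _

/-- The constant field `ξ` is itself parallel because the ray is a geodesic, so inserting it
preserves parallelism of all slots. -/
theorem hasDerivWithinAt_prependVector {ξ : V} {n : ℕ} {W : ℝ → Fin n → V} {s : Set ℝ} {t : ℝ}
    (hξ : christoffel g (t • ξ) ξ ξ = 0)
    (hW : ∀ i, HasDerivWithinAt (fun r => W r i) (-christoffel g (t • ξ) ξ (W t i)) s t) (k : ℕ) :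
    ∀ i, HasDerivWithinAt (fun r => prependVector ξ (W r) k i)
      (-christoffel g (t • ξ) ξ (prependVector ξ (W t) k i)) s t := by
  induction k with
  | zero => exact hW
  | succ k ih =>
    intro i
    refine Fin.cases (n := n + k) ?_ (fun j => ?_) i
    · simpa [prependVector, hξ] using hasDerivWithinAt_const t s ξ
    · simpa [prependVector] using ih j

theorem norm_prependVector_prod {E : Type*} [NormedAddCommGroup E] (ξ : E) {n : ℕ}
    (v : Fin n → E) (k : ℕ) :
    ∏ i, ‖prependVector ξ v k i‖ = ‖ξ‖ ^ k * ∏ i, ‖v i‖ := by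
  induction k with
  | zero => simp [prependVector]
  | succ k ih =>
    change ∏ i : Fin (n + k + 1), _ = _
    rw [Fin.prod_univ_succ]
    simp only [prependVector, Fin.cons_zero, Fin.cons_succ, ih]
    ring

end Line

/-! ### Covariant derivatives of the curvature as bilinear forms along a ray -/

section CurvatureForm

variable {V : Type*} [NormedAddCommGroup V] [NormedSpace ℝ V] [FiniteDimensional ℝ V]

/-- The bilinear form `(x, y) ↦ (∇^k_{ξ, …, ξ} R)_p (x, ξ, ξ, y)`. -/
def curvatureForm (g : V → V →L[ℝ] V →L[ℝ] ℝ) (k : ℕ) (p ξ : V) : V →L[ℝ] V →L[ℝ] ℝ :=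
  LinearMap.toContinuousLinearMap
    ((LinearMap.toContinuousLinearMap : (V →ₗ[ℝ] ℝ) ≃ₗ[ℝ] (V →L[ℝ] ℝ)).toLinearMap ∘ₗ
      LinearMap.mk₂ ℝ (fun x y => insertFirst ξ k (nablaCurvature g k p) ![x, ξ, ξ, y])
        (fun x x' y => by
          have e : ∀ u : V, Function.update ![0, ξ, ξ, y] (0 : Fin 4) u = ![u, ξ, ξ, y] := by
            intro u; funext j; fin_cases j <;> rfl
          simpa only [e] using
            (insertFirst ξ k (nablaCurvature g k p)).map_update_add ![0, ξ, ξ, y] 0 x x')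
        (fun c x y => by
          have e : ∀ u : V, Function.update ![0, ξ, ξ, y] (0 : Fin 4) u = ![u, ξ, ξ, y] := by
            intro u; funext j; fin_cases j <;> rfl
          simpa only [e] using
            (insertFirst ξ k (nablaCurvature g k p)).map_update_smul ![0, ξ, ξ, y] 0 c x)
        (fun x y y' => by
          have e : ∀ u : V, Function.update ![x, ξ, ξ, 0] (3 : Fin 4) u = ![x, ξ, ξ, u] := by
            intro u; funext j; fin_cases j <;> rfl
          simpa only [e] using
            (insertFirst ξ k (nablaCurvature g k p)).map_update_add ![x, ξ, ξ, 0] 3 y y')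
        (fun c x y => by
          have e : ∀ u : V, Function.update ![x, ξ, ξ, 0] (3 : Fin 4) u = ![x, ξ, ξ, u] := by
            intro u; funext j; fin_cases j <;> rfl
          simpa only [e] using
            (insertFirst ξ k (nablaCurvature g k p)).map_update_smul ![x, ξ, ξ, 0] 3 c y))

theorem curvatureForm_apply (g : V → V →L[ℝ] V →L[ℝ] ℝ) (k : ℕ) (p ξ x y : V) :
    curvatureForm g k p ξ x y = nablaCurvature g k p (prependVector ξ ![x, ξ, ξ, y] k) :=
  insertFirst_apply ξ k _ _

theorem curvatureForm_zero_apply (g : V → V →L[ℝ] V →L[ℝ] ℝ) (p ξ x y : V) :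
    curvatureForm g 0 p ξ x y = g p (curvatureOp g p x ξ ξ) y := rfl

theorem symCurvatureForm_eq_curvatureForm (g : V → V →L[ℝ] V →L[ℝ] ℝ) (k : ℕ) (ξ : V) :
    symCurvatureForm g k ξ = curvatureForm g k 0 ξ := rfl

theorem norm_curvatureForm_le (g : V → V →L[ℝ] V →L[ℝ] ℝ) (k : ℕ) (p ξ : V) :
    ‖curvatureForm g k p ξ‖ ≤ ‖nablaCurvature g k p‖ * ‖ξ‖ ^ (k + 2) := by
  refine ContinuousLinearMap.opNorm_le_bound₂ _ (by positivity) fun x y => ?_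
  rw [curvatureForm_apply]
  refine (ContinuousMultilinearMap.le_opNorm _ _).trans (le_of_eq ?_)
  rw [norm_prependVector_prod, Fin.prod_univ_four]
  simp only [Matrix.cons_val]
  ring

theorem hasDerivWithinAt_curvatureForm_parallel {g : V → V →L[ℝ] V →L[ℝ] ℝ} {ξ : V} {k : ℕ}
    {s : Set ℝ} {t : ℝ} (hd : DifferentiableAt ℝ (nablaCurvature g k) (t • ξ))
    (hξ : christoffel g (t • ξ) ξ ξ = 0) {X Y : ℝ → V}
    (hX : HasDerivWithinAt X (-christoffel g (t • ξ) ξ (X t)) s t)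
    (hY : HasDerivWithinAt Y (-christoffel g (t • ξ) ξ (Y t)) s t) :
    HasDerivWithinAt (fun r => curvatureForm g k (r • ξ) ξ (X r) (Y r))
      (curvatureForm g (k + 1) (t • ξ) ξ (X t) (Y t)) s t := by
  simp only [curvatureForm_apply]
  refine hasDerivWithinAt_tensor_parallel hd
    (hasDerivWithinAt_prependVector (W := fun r => ![X r, ξ, ξ, Y r]) hξ (fun i => ?_) k)
  have hc : HasDerivWithinAt (fun _ : ℝ => ξ) (-christoffel g (t • ξ) ξ ξ) s t := by
    simpa [hξ] using hasDerivWithinAt_const t s ξ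
  fin_cases i
  exacts [hX, hc, hc, hY]

end CurvatureForm

/-! ### The Leibniz recursion for derivatives of solutions of the Jacobi equation -/

section JacobiJet

/-- The successive derivatives of a solution of `A'' = -K A` in terms of the derivatives of `K` and
the initial values `a₀ = A`, `a₁ = A'`. -/
def jacobiJet {𝔸 : Type*} [Ring 𝔸] (K : ℕ → 𝔸) (a₀ a₁ : 𝔸) : ℕ → 𝔸
  | 0 => a₀
  | 1 => a₁
  | n + 2 => -∑ ij ∈ (Finset.HasAntidiagonal.antidiagonal n).attach,
      n.choose ij.1.1 • (K ij.1.1 * jacobiJet K a₀ a₁ ij.1.2)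
  decreasing_by
    have := Finset.HasAntidiagonal.mem_antidiagonal.mp ij.2
    omega

@[simp]
theorem jacobiJet_zero {𝔸 : Type*} [Ring 𝔸] (K : ℕ → 𝔸) (a₀ a₁ : 𝔸) :
    jacobiJet K a₀ a₁ 0 = a₀ := by rw [jacobiJet]

@[simp]
theorem jacobiJet_one {𝔸 : Type*} [Ring 𝔸] (K : ℕ → 𝔸) (a₀ a₁ : 𝔸) :
    jacobiJet K a₀ a₁ 1 = a₁ := by rw [jacobiJet]

theorem jacobiJet_add_two {𝔸 : Type*} [Ring 𝔸] (K : ℕ → 𝔸) (a₀ a₁ : 𝔸) (n : ℕ) :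
    jacobiJet K a₀ a₁ (n + 2) = -∑ ij ∈ Finset.HasAntidiagonal.antidiagonal n,
      n.choose ij.1 • (K ij.1 * jacobiJet K a₀ a₁ ij.2) := by
  rw [jacobiJet, Finset.sum_attach (Finset.HasAntidiagonal.antidiagonal n)
    fun ij => n.choose ij.1 • (K ij.1 * jacobiJet K a₀ a₁ ij.2)]

variable {𝔸 : Type*} [NormedRing 𝔸] [NormedAlgebra ℝ 𝔸]

theorem hasDerivWithinAt_jacobiJet {K : ℕ → ℝ → 𝔸} {a₀ a₁ : ℝ → 𝔸} {s : Set ℝ} {t : ℝ}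
    (hK : ∀ j, HasDerivWithinAt (K j) (K (j + 1) t) s t) (h₀ : HasDerivWithinAt a₀ (a₁ t) s t)
    (h₁ : HasDerivWithinAt a₁ (-(K 0 t * a₀ t)) s t) (n : ℕ) :
    HasDerivWithinAt (fun r => jacobiJet (fun j => K j r) (a₀ r) (a₁ r) n)
      (jacobiJet (fun j => K j t) (a₀ t) (a₁ t) (n + 1)) s t := by
  induction n using Nat.strong_induction_on with
  | _ n ih =>
    match n, ih with
    | 0, _ => simpa using h₀
    | 1, _ => simpa [jacobiJet_add_two] using h₁
    | n + 2, ih =>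
      have hsum := (HasDerivWithinAt.fun_sum (u := Finset.HasAntidiagonal.antidiagonal n) fun ij hij =>
        ((hK ij.1).mul (ih ij.2 (by have := Finset.HasAntidiagonal.mem_antidiagonal.mp hij; omega))).const_smul
          (n.choose ij.1 : ℝ)).neg
      simp only [jacobiJet_add_two _ _ _ n, ← Nat.cast_smul_eq_nsmul ℝ]
      refine hsum.congr_deriv ?_
      -- Pascal's rule splits the sum of order `n + 1` into the two halves produced by the product
      -- rule.
      rw [jacobiJet_add_two _ _ _ (n + 1), Finset.sum_antidiagonal_choose_succ_nsmul
        (fun i j => K i t * jacobiJet (fun j => K j t) (a₀ t) (a₁ t) j) n, add_comm,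
        ← Finset.sum_add_distrib]
      congr 1
      refine Finset.sum_congr rfl fun ij hij => ?_
      rw [Nat.cast_smul_eq_nsmul, smul_add, ← Nat.choose_symm_of_eq_add
        (Finset.HasAntidiagonal.mem_antidiagonal.mp hij).symm]

/-- Each application of the recursion trades two derivatives for a factor `K j` of size `x ^ (j +
2)`, so the weight is preserved; `a₁` starts with weight `0`. The constant `D` depends only on `C`
and `n`, which gives uniformity in `ξ`. -/
theorem exists_norm_jacobiJet_le (C : ℝ) (hC : 0 ≤ C) (n : ℕ) :
    ∃ D : ℝ, 0 ≤ D ∧ ∀ (x : ℝ) (K : ℕ → 𝔸) (a₀ a₁ : 𝔸), 0 ≤ x → x ≤ 1 →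
      (∀ j < n, ‖K j‖ ≤ C * x ^ (j + 2)) → ‖a₀‖ ≤ C → ‖a₁‖ ≤ C →
      ∀ m ≤ n, ‖jacobiJet K a₀ a₁ m‖ ≤ D * x ^ (m - 1) := by
  induction n with
  | zero =>
    refine ⟨C, hC, fun x K a₀ a₁ _ _ _ h₀ _ m hm => ?_⟩
    obtain rfl : m = 0 := by omega
    simpa using h₀
  | succ n ih =>
    obtain ⟨D, hD, h⟩ := ih
    let c : ℝ := ∑ ij ∈ Finset.HasAntidiagonal.antidiagonal (n - 1), ((n - 1).choose ij.1 : ℝ)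
    have hc : 0 ≤ c := Finset.sum_nonneg fun _ _ => Nat.cast_nonneg _
    refine ⟨D + C + c * (C * D), by positivity, fun x K a₀ a₁ hx hx1 hK h₀ h₁ m hm => ?_⟩
    have hn := h x K a₀ a₁ hx hx1 (fun j hj => hK j (by omega)) h₀ h₁
    have hxp : ∀ k : ℕ, 0 ≤ x ^ k := fun k => pow_nonneg hx k
    rcases hm.lt_or_eq with hlt | rfl
    · refine (hn m (by omega)).trans (mul_le_mul_of_nonneg_right ?_ (hxp _))
      nlinarith [mul_nonneg hc (mul_nonneg hC hD)]
    · cases n with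
      | zero =>
        simp only [jacobiJet_one, zero_add, Nat.sub_self, pow_zero, mul_one]
        nlinarith [mul_nonneg hc (mul_nonneg hC hD)]
      | succ k =>
        have key : ‖jacobiJet K a₀ a₁ (k + 2)‖ ≤ c * (C * D) * x ^ (k + 1) := by
          rw [jacobiJet_add_two, norm_neg, Finset.sum_mul, Finset.sum_mul]
          refine norm_sum_le_of_le _ fun ij hij => ?_
          have hk := Finset.HasAntidiagonal.mem_antidiagonal.mp hij
          rw [← Nat.cast_smul_eq_nsmul ℝ, norm_smul, Real.norm_natCast, mul_assoc]
          refine mul_le_mul_of_nonneg_left ?_ (Nat.cast_nonneg _)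
          calc ‖K ij.1 * jacobiJet K a₀ a₁ ij.2‖
              ≤ (C * x ^ (ij.1 + 2)) * (D * x ^ (ij.2 - 1)) :=
                norm_mul_le_of_le (hK _ (by omega)) (hn _ (by omega))
            _ = C * D * x ^ (ij.1 + 2 + (ij.2 - 1)) := by rw [pow_add]; ring
            -- The exponent equals `k + 1` if `ij.2 ≥ 1`. If `ij.2 = 0`, truncated subtraction gives
            -- `k + 2`, which is harmless since `x ≤ 1`.
            _ ≤ C * D * x ^ (k + 1) := mul_le_mul_of_nonneg_left
                (pow_le_pow_of_le_one hx hx1 (by omega)) (mul_nonneg hC hD)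
        refine key.trans (mul_le_mul_of_nonneg_right ?_ (hxp _))
        linarith

end JacobiJet

/-! ### The universal polynomials: homogeneity and comparison with the Jacobi recursion -/

section Universal

theorem Qtilde_succ (n : ℕ) : Qtilde (n + 1) =
    (-(1 / (((n + 1 : ℕ) : ℝ) * (((n + 1 : ℕ) : ℝ) + 1)))) • ∑ l ∈ (Finset.Icc 2 (n + 1)).attach,
      (((n + 1).choose l.1 : ℝ) * ((l.1 : ℝ) - 1) * (l.1 : ℝ)) •
        (FreeAlgebra.ι ℝ ⟨l.1, (Finset.mem_Icc.mp l.2).1⟩ * Qtilde (n + 1 - l.1)) := by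
  rw [Qtilde]

theorem IsHomogeneousOfDegree.ι_mul {d : ℕ} {Q : FreeAlg} (hQ : IsHomogeneousOfDegree d Q)
    (i : {n : ℕ // 2 ≤ n}) : IsHomogeneousOfDegree (i.1 + d) (FreeAlgebra.ι ℝ i * Q) := by
  have h : Submodule.span ℝ {M : FreeAlg | ∃ I : List {n : ℕ // 2 ≤ n},
      (I.map Subtype.val).sum = d ∧ M = (I.map (FreeAlgebra.ι ℝ)).prod} ≤
      (Submodule.span ℝ {M : FreeAlg | ∃ I : List {n : ℕ // 2 ≤ n},
      (I.map Subtype.val).sum = i.1 + d ∧ M = (I.map (FreeAlgebra.ι ℝ)).prod}).comap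
        (LinearMap.mulLeft ℝ (FreeAlgebra.ι ℝ i)) := by
    rw [Submodule.span_le]
    rintro M ⟨I, hI, rfl⟩
    exact Submodule.subset_span ⟨i :: I, by rw [List.map_cons, List.sum_cons, hI], by simp⟩
  exact h hQ

theorem isHomogeneousOfDegree_Qtilde (k : ℕ) : IsHomogeneousOfDegree k (Qtilde k) := by
  induction k using Nat.strong_induction_on with
  | _ k ih =>
    match k, ih with
    | 0, _ =>
      rw [Qtilde]
      exact Submodule.subset_span ⟨[], rfl, rfl⟩
    | n + 1, ih =>
      rw [Qtilde_succ]
      refine Submodule.smul_mem _ _ (Submodule.sum_mem _ fun l _ => Submodule.smul_mem _ _ ?_)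
      have hl := Finset.mem_Icc.mp l.2
      have h := (ih (n + 1 - l.1) (by omega)).ι_mul ⟨l.1, hl.1⟩
      rwa [Nat.add_sub_cancel' hl.2] at h

theorem substitute_apply {V : Type*} [NormedAddCommGroup V] [NormedSpace ℝ V]
    (A : ℕ → V → V →L[ℝ] V) (Q : FreeAlg) (ξ : V) :
    substitute A Q ξ = FreeAlgebra.lift ℝ (fun i : {n : ℕ // 2 ≤ n} => A (i.1 - 2) ξ) Q := by
  have h : (Pi.evalAlgHom ℝ (fun _ : V => V →L[ℝ] V) ξ).comp (substitute A) =
      FreeAlgebra.lift ℝ (fun i : {n : ℕ // 2 ≤ n} => A (i.1 - 2) ξ) := by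
    ext i
    simp [substitute]
  exact AlgHom.congr_fun h Q

theorem lift_Qtilde_succ {𝔸 : Type*} [Ring 𝔸] [Algebra ℝ 𝔸] (K : ℕ → 𝔸) (n : ℕ) :
    FreeAlgebra.lift ℝ (fun i : {n : ℕ // 2 ≤ n} => K (i.1 - 2)) (Qtilde (n + 1)) =
      (-(1 / (((n : ℝ) + 1) * ((n : ℝ) + 2)))) • ∑ i ∈ Finset.range n,
        (((n + 1).choose (i + 2) : ℝ) * ((i : ℝ) + 1) * ((i : ℝ) + 2)) •
          (K i * FreeAlgebra.lift ℝ (fun i : {n : ℕ // 2 ≤ n} => K (i.1 - 2))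
            (Qtilde (n - 1 - i))) := by
  rw [Qtilde_succ]
  simp only [map_smul, map_sum, map_mul, FreeAlgebra.lift_ι_apply]
  rw [Finset.sum_attach (Finset.Icc 2 (n + 1)) fun l =>
    (((n + 1).choose l : ℝ) * ((l : ℝ) - 1) * (l : ℝ)) • (K (l - 2) *
      FreeAlgebra.lift ℝ (fun i : {n : ℕ // 2 ≤ n} => K (i.1 - 2)) (Qtilde (n + 1 - l))),
    ← Finset.Ico_add_one_right_eq_Icc, Finset.sum_Ico_eq_sum_range]
  congr 1
  · push_cast; ring
  · refine Finset.sum_congr (by congr 1) fun i _ => ?_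
    congr 1
    · rw [add_comm 2 i]; push_cast; ring
    · rw [Nat.add_sub_cancel_left, show n + 1 - (2 + i) = n - 1 - i by omega]

/-- The universal expressions `Q̃_k` are the Taylor coefficients of the solution of
`A'' = -K A`, `A(0) = 0`, `A'(0) = 1`. -/
theorem jacobiJet_succ_eq_lift_Qtilde {𝔸 : Type*} [Ring 𝔸] [Algebra ℝ 𝔸] (K : ℕ → 𝔸) (k : ℕ) :
    jacobiJet K 0 1 (k + 1) = ((k : ℝ) + 1) •
      FreeAlgebra.lift ℝ (fun i : {n : ℕ // 2 ≤ n} => K (i.1 - 2)) (Qtilde k) := by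
  induction k using Nat.strong_induction_on with
  | _ k ih =>
    match k, ih with
    | 0, _ => simp [Qtilde]
    | n + 1, ih =>
      -- The last term of the antidiagonal sum contains the jet of order `0`, which is zero; the
      -- others match under `ℓ = i + 2`.
      rw [jacobiJet_add_two, lift_Qtilde_succ, Finset.Nat.sum_antidiagonal_eq_sum_range_succ_mk,
        Finset.sum_range_succ, Nat.sub_self, jacobiJet_zero, mul_zero, smul_zero, add_zero, smul_smul,
        Finset.smul_sum, ← Finset.sum_neg_distrib]
      refine Finset.sum_congr rfl fun i hi => ?_
      have hi' := Finset.mem_range.mp hi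
      obtain ⟨m, rfl⟩ : ∃ m, n = i + m + 1 := ⟨n - i - 1, by omega⟩
      rw [show i + m + 1 - i = m + 1 by omega, show i + m + 1 - 1 - i = m by omega,
        ih m (by omega), mul_smul_comm, ← Nat.cast_smul_eq_nsmul ℝ, smul_smul, smul_smul,
        ← neg_smul]
      congr 1
      have e1 : ((i + m + 1).choose i : ℝ) * ((i ! : ℝ) * ((m + 1) ! : ℝ)) = ((i + m + 1) ! : ℝ) := by
        have := Nat.choose_mul_factorial_mul_factorial (show i ≤ i + m + 1 by omega)
        rw [show i + m + 1 - i = m + 1 by omega] at this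
        rw [← mul_assoc]
        exact_mod_cast this
      have e2 : ((i + m + 1 + 1).choose (i + 2) : ℝ) * (((i + 2) ! : ℝ) * (m ! : ℝ)) =
          ((i + m + 1 + 1) ! : ℝ) := by
        have := Nat.choose_mul_factorial_mul_factorial (show i + 2 ≤ i + m + 1 + 1 by omega)
        rw [show i + m + 1 + 1 - (i + 2) = m by omega] at this
        rw [← mul_assoc]
        exact_mod_cast this
      have hif : (i ! : ℝ) ≠ 0 := by exact_mod_cast i.factorial_ne_zero
      have hmf : (m ! : ℝ) ≠ 0 := by exact_mod_cast m.factorial_ne_zero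
      rw [Nat.factorial_succ (i + m + 1), Nat.cast_mul, ← e1, Nat.factorial_succ (i + 1),
        Nat.factorial_succ i, Nat.factorial_succ m] at e2
      push_cast at e2 ⊢
      -- With `k = i + m + 2` and `ℓ = i + 2` this is `binom(k, ℓ) (ℓ-1) ℓ = k (k-ℓ+1) binom(k-1,
      -- ℓ-2)`, the reason for the weights in the definition of `Q̃_k`.
      have e3 : ((i + m + 1 + 1).choose (i + 2) : ℝ) * ((i : ℝ) + 1) * ((i : ℝ) + 2) =
          ((i : ℝ) + m + 1 + 1) * ((i + m + 1).choose i : ℝ) * ((m : ℝ) + 1) := by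
        have h : (i ! : ℝ) * (m ! : ℝ) ≠ 0 := mul_ne_zero hif hmf
        refine mul_right_cancel₀ h ?_
        linear_combination e2
      rw [e3]
      field_simp
      ring

end Universal

/-! ### Parallel transport along rays and the transported Jacobi equation -/

section Transport

variable {V : Type*} [NormedAddCommGroup V] [NormedSpace ℝ V]
  {g : V → V →L[ℝ] V →L[ℝ] ℝ} {U : Set V} {ξ : V} {P S : ℝ → V →L[ℝ] V}

/-- `P t` and `S t` are the parallel transports along `t ↦ t • ξ` from `t • ξ` to the origin and
from the origin to `t • ξ`. -/
structure IsTransportPair (g : V → V →L[ℝ] V →L[ℝ] ℝ) (ξ : V) (P S : ℝ → V →L[ℝ] V) : Prop where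
  back_zero : P 0 = 1
  forth_zero : S 0 = 1
  hasDeriv_back : ∀ t ∈ Icc (0 : ℝ) 1,
    HasDerivWithinAt P (P t ∘L christoffel g (t • ξ) ξ) (Icc 0 1) t
  hasDeriv_forth : ∀ t ∈ Icc (0 : ℝ) 1,
    HasDerivWithinAt S (-(christoffel g (t • ξ) ξ ∘L S t)) (Icc 0 1) t

theorem hasDerivWithinAt_smul_back (h : IsTransportPair g ξ P S) {t : ℝ}
    (ht : t ∈ Icc (0 : ℝ) 1) : HasDerivWithinAt (fun t => t • P t)
      (P t * (1 + t • christoffel g (t • ξ) ξ)) (Icc 0 1) t := by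
  refine ((hasDerivWithinAt_id t _).smul (h.hasDeriv_back t ht)).congr_deriv ?_
  ext v
  simp [add_comm]

namespace IsTransportPair

theorem hasDeriv_forth_apply (h : IsTransportPair g ξ P S) (v : V) {t : ℝ}
    (ht : t ∈ Icc (0 : ℝ) 1) :
    HasDerivWithinAt (fun r => S r v) (-christoffel g (t • ξ) ξ (S t v)) (Icc 0 1) t := by
  simpa using (h.hasDeriv_forth t ht).clm_apply (hasDerivWithinAt_const t _ v)

/-- The derivative of `P t (Y t)` is zero, as the Christoffel terms from `P` and `Y` cancel. -/
theorem back_apply_parallel (h : IsTransportPair g ξ P S) {Y : ℝ → V}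
    (hY : IsParallelAlong g (fun t => t • ξ) Y (Icc 0 1)) {t : ℝ} (ht : t ∈ Icc (0 : ℝ) 1) :
    P t (Y t) = Y 0 := by
  have key := eq_of_hasDerivWithinAt_zero (f := fun t => P t (Y t)) (fun s hs => by
    simpa using (h.hasDeriv_back s hs).clm_apply (isParallelAlong_line_iff.mp hY s hs)) ht
  simpa [h.back_zero] using key

theorem isParallelAlong_forth (h : IsTransportPair g ξ P S) (v : V) :
    IsParallelAlong g (fun t => t • ξ) (fun t => S t v) (Icc 0 1) :=
  isParallelAlong_line_iff.mpr fun _ ht => h.hasDeriv_forth_apply v ht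

theorem back_mul_forth (h : IsTransportPair g ξ P S) {t : ℝ} (ht : t ∈ Icc (0 : ℝ) 1) :
    P t * S t = 1 := by
  ext v
  simpa [h.forth_zero] using h.back_apply_parallel (h.isParallelAlong_forth v) ht

theorem norm_back_le (h : IsTransportPair g ξ P S)
    (hΓ : ∀ t ∈ Icc (0 : ℝ) 1, ‖christoffel g (t • ξ) ξ‖ ≤ 1) {t : ℝ} (ht : t ∈ Icc (0 : ℝ) 1) :
    ‖P t‖ ≤ Real.exp 1 := by
  refine (norm_le_of_hasDerivWithinAt_of_norm_le (C := 1) h.hasDeriv_back (fun s hs => ?_) ?_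
    ht).trans (one_mul _).le
  · exact (ContinuousLinearMap.opNorm_comp_le _ _).trans
      (mul_le_of_le_one_right (norm_nonneg _) (hΓ s hs))
  · rw [h.back_zero]
    exact ContinuousLinearMap.norm_id_le

theorem norm_forth_le (h : IsTransportPair g ξ P S)
    (hΓ : ∀ t ∈ Icc (0 : ℝ) 1, ‖christoffel g (t • ξ) ξ‖ ≤ 1) {t : ℝ} (ht : t ∈ Icc (0 : ℝ) 1) :
    ‖S t‖ ≤ Real.exp 1 := by
  refine (norm_le_of_hasDerivWithinAt_of_norm_le (C := 1) h.hasDeriv_forth (fun s hs => ?_) ?_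
    ht).trans (one_mul _).le
  · rw [norm_neg]
    exact (ContinuousLinearMap.opNorm_comp_le _ _).trans
      (mul_le_of_le_one_left (norm_nonneg _) (hΓ s hs))
  · rw [h.forth_zero]
    exact ContinuousLinearMap.norm_id_le

variable [FiniteDimensional ℝ V]

theorem forth_mul_back (h : IsTransportPair g ξ P S) {t : ℝ} (ht : t ∈ Icc (0 : ℝ) 1) :
    S t * P t = 1 := by
  have h1 : ((P t : V →L[ℝ] V) : V →ₗ[ℝ] V) * (S t : V →ₗ[ℝ] V) = 1 := by
    ext v
    exact DFunLike.congr_fun (h.back_mul_forth ht) v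
  rw [_root_.mul_eq_one_comm] at h1
  ext v
  exact LinearMap.congr_fun h1 v

theorem isBackwardsParallelTransport (h : IsTransportPair g ξ P S) :
    IsBackwardsParallelTransport g ξ (P 1) := by
  have h1 : (1 : ℝ) ∈ Icc (0 : ℝ) 1 := ⟨zero_le_one, le_rfl⟩
  refine ⟨fun v => ⟨fun t => S t (P 1 v), h.isParallelAlong_forth _, ?_⟩,
    fun Y hY => h.back_apply_parallel hY h1⟩
  exact DFunLike.congr_fun (h.forth_mul_back h1) v

/-- Every vector is the endpoint of a parallel field, so the defining property determines the
operator and the choice is immaterial. -/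
theorem backwardsParallelTransport_eq (h : IsTransportPair g ξ P S) :
    backwardsParallelTransport g ξ = P 1 := by
  have hex : ∃ A, IsBackwardsParallelTransport g ξ A := ⟨P 1, h.isBackwardsParallelTransport⟩
  rw [backwardsParallelTransport, dif_pos hex]
  ext v
  obtain ⟨Y, hY, rfl⟩ := h.isBackwardsParallelTransport.1 v
  rw [hex.choose_spec.2 Y hY, h.isBackwardsParallelTransport.2 Y hY]

theorem isUnit_back_one (h : IsTransportPair g ξ P S) : IsUnit (P 1) :=
  have h1 : (1 : ℝ) ∈ Icc (0 : ℝ) 1 := ⟨zero_le_one, le_rfl⟩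
  ⟨⟨P 1, S 1, h.back_mul_forth h1, h.forth_mul_back h1⟩, rfl⟩

end IsTransportPair

variable [FiniteDimensional ℝ V]

theorem exists_isTransportPair (hU : IsOpen U) (hstar : StarConvex ℝ (0 : V) U)
    (hg : IsPseudoRiemannianMetricOn g U) (hξ : ξ ∈ U) :
    ∃ P S : ℝ → V →L[ℝ] V, IsTransportPair g ξ P S := by
  have hΓ : ContinuousOn (fun t : ℝ => christoffel g (t • ξ) ξ) (Icc 0 1) :=
    (((contDiffOn_christoffel hU hg).continuousOn.comp (by fun_prop)
      fun t ht => hstar.smul_mem hξ ht.1 ht.2).clm_apply continuousOn_const)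
  obtain ⟨P, hP0, hP⟩ := exists_linearODE_solution
    (A := fun t => (ContinuousLinearMap.compL ℝ V V V).flip (christoffel g (t • ξ) ξ))
    ((ContinuousLinearMap.continuous _).comp_continuousOn hΓ) 1
  obtain ⟨S, hS0, hS⟩ := exists_linearODE_solution
    (A := fun t => -ContinuousLinearMap.compL ℝ V V V (christoffel g (t • ξ) ξ))
    ((ContinuousLinearMap.continuous _).comp_continuousOn hΓ).neg 1
  exact ⟨P, S, hP0, hS0, hP, hS⟩

/-- The endomorphisms `b⁻¹ ∘ (∇^k_{ξ, …, ξ} R)_{t ξ}(S ·, ξ, ξ, S ·)` of `V`, that is, the iterated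
covariant derivatives of the Jacobi operator, transported to the origin. -/
def transportedCurvature (b : V →L[ℝ] V →L[ℝ] ℝ) (g : V → V →L[ℝ] V →L[ℝ] ℝ) (ξ : V)
    (S : ℝ → V →L[ℝ] V) (k : ℕ) (t : ℝ) : V →L[ℝ] V :=
  b.inverse ∘L (curvatureForm g k (t • ξ) ξ).bilinearComp (S t) (S t)

theorem transportedCurvature_zero (b : V →L[ℝ] V →L[ℝ] ℝ) (hS : S 0 = 1) (k : ℕ) :
    transportedCurvature b g ξ S k 0 = symCurvatureOp b g k ξ := by
  rw [transportedCurvature, symCurvatureOp, symCurvatureForm_eq_curvatureForm, hS, zero_smul]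
  rfl

theorem norm_transportedCurvature_le (b : V →L[ℝ] V →L[ℝ] ℝ) (k : ℕ) {t M : ℝ}
    (hS : ‖S t‖ ≤ M) : ‖transportedCurvature b g ξ S k t‖ ≤
      ‖b.inverse‖ * ‖nablaCurvature g k (t • ξ)‖ * M ^ 2 * ‖ξ‖ ^ (k + 2) := by
  have hM : 0 ≤ M := (norm_nonneg _).trans hS
  have h1 : ‖(curvatureForm g k (t • ξ) ξ).bilinearComp (S t) (S t)‖ ≤
      ‖nablaCurvature g k (t • ξ)‖ * ‖ξ‖ ^ (k + 2) * M ^ 2 := by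
    refine ContinuousLinearMap.opNorm_le_bound₂ _ (by positivity) fun x y => ?_
    rw [ContinuousLinearMap.bilinearComp_apply]
    calc _ ≤ ‖curvatureForm g k (t • ξ) ξ‖ * ‖S t x‖ * ‖S t y‖ :=
          ContinuousLinearMap.le_opNorm₂ _ _ _
      _ ≤ (‖nablaCurvature g k (t • ξ)‖ * ‖ξ‖ ^ (k + 2)) * (M * ‖x‖) * (M * ‖y‖) := by
          gcongr
          · exact norm_curvatureForm_le g k _ _
          · exact (S t).le_of_opNorm_le hS x
          · exact (S t).le_of_opNorm_le hS y
      _ = _ := by ring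
  calc _ ≤ ‖b.inverse‖ * (‖nablaCurvature g k (t • ξ)‖ * ‖ξ‖ ^ (k + 2) * M ^ 2) :=
        (ContinuousLinearMap.opNorm_comp_le _ _).trans
          (mul_le_mul_of_nonneg_left h1 (norm_nonneg _))
    _ = _ := by ring

/-- Evaluated on the parallel fields `S t x`, `S t y` and `ξ`, a tensor changes only by its
covariant derivative in the direction `ξ`. -/
theorem hasDerivWithinAt_transportedCurvature (b : V →L[ℝ] V →L[ℝ] ℝ) (hU : IsOpen U)
    (hstar : StarConvex ℝ (0 : V) U) (hg : IsPseudoRiemannianMetricOn g U)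
    (hnormal : IsNormal g U) (hξ : ξ ∈ U) (h : IsTransportPair g ξ P S) (k : ℕ) {t : ℝ}
    (ht : t ∈ Icc (0 : ℝ) 1) :
    HasDerivWithinAt (transportedCurvature b g ξ S k) (transportedCurvature b g ξ S (k + 1) t)
      (Icc 0 1) t := by
  have hd : DifferentiableAt ℝ (nablaCurvature g k) (t • ξ) :=
    ((contDiffOn_nablaCurvature hU hg k).contDiffAt
      (hU.mem_nhds (hstar.smul_mem hξ ht.1 ht.2))).differentiableAt (by simp)
  refine (hasDerivWithinAt_const t _ b.inverse).clm_comp (d := fun t =>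
    (curvatureForm g k (t • ξ) ξ).bilinearComp (S t) (S t)) (d' :=
    (curvatureForm g (k + 1) (t • ξ) ξ).bilinearComp (S t) (S t)) ?_ |>.congr_deriv (by
      simp [transportedCurvature])
  refine hasDerivWithinAt_clm_of_apply fun x => hasDerivWithinAt_clm_of_apply fun y => ?_
  simp only [ContinuousLinearMap.bilinearComp_apply]
  exact hasDerivWithinAt_curvatureForm_parallel hd (christoffel_radial hnormal hξ ht)
    (h.hasDeriv_forth_apply x ht) (h.hasDeriv_forth_apply y ht)

/-- Parallel transport is isometric. This allows the fixed form `g 0` to replace `g (t • ξ)` when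
the curvature form is turned into an operator. -/
theorem metric_forth (hU : IsOpen U) (hstar : StarConvex ℝ (0 : V) U)
    (hg : IsPseudoRiemannianMetricOn g U) (hξ : ξ ∈ U) (h : IsTransportPair g ξ P S) {t : ℝ}
    (ht : t ∈ Icc (0 : ℝ) 1) (x y : V) : g (t • ξ) (S t x) (S t y) = g 0 x y := by
  have key := eq_of_hasDerivWithinAt_zero (f := fun t => g (t • ξ) (S t x) (S t y))
    (fun s hs => ?_) ht
  · simpa [h.forth_zero] using key
  have hmem : s • ξ ∈ U := hstar.smul_mem hξ hs.1 hs.2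
  have hd : DifferentiableAt ℝ g (s • ξ) :=
    (hg.smooth.contDiffAt (hU.mem_nhds hmem)).differentiableAt (by simp)
  have h1 : HasDerivWithinAt (fun r : ℝ => g (r • ξ)) (fderiv ℝ g (s • ξ) ξ) (Icc 0 1) s :=
    hd.hasFDerivAt.comp_hasDerivWithinAt s (hasDerivWithinAt_smul_line ξ _ s)
  have h2 := (h1.clm_apply (h.hasDeriv_forth_apply x hs)).clm_apply (h.hasDeriv_forth_apply y hs)
  refine h2.congr_deriv ?_
  simp [fderiv_metric_apply hU hg hmem]

/-- The transported Jacobi operator. -/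
theorem transportedCurvature_zero_mul_back (hU : IsOpen U) (h0 : (0 : V) ∈ U)
    (hstar : StarConvex ℝ (0 : V) U) (hg : IsPseudoRiemannianMetricOn g U) (hξ : ξ ∈ U)
    (h : IsTransportPair g ξ P S) {t : ℝ} (ht : t ∈ Icc (0 : ℝ) 1) (v : V) :
    transportedCurvature (g 0) g ξ S 0 t (P t v) = P t (curvatureOp g (t • ξ) v ξ ξ) := by
  have hSP : ∀ w, S t (P t w) = w := fun w => DFunLike.congr_fun (h.forth_mul_back ht) w
  have hform : (curvatureForm g 0 (t • ξ) ξ).bilinearComp (S t) (S t) (P t v) =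
      g 0 (P t (curvatureOp g (t • ξ) v ξ ξ)) := by
    ext y
    rw [ContinuousLinearMap.bilinearComp_apply, hSP, curvatureForm_zero_apply,
      ← metric_forth hU hstar hg hξ h ht, hSP]
  rw [transportedCurvature, ContinuousLinearMap.comp_apply, hform,
    (hg.pseudoEuclidean 0 h0).isInvertible.inverse_apply_self]

/-- With `Γ = christoffel g (t • ξ) ξ` and `P' = P Γ`, the product rule gives `P (2 Γ + t Γ' + t Γ
Γ)`, and `jacobi_radial` identifies the bracket with the negative Jacobi operator times `t`. -/
theorem hasDerivWithinAt_deriv_smul_back (hU : IsOpen U) (h0 : (0 : V) ∈ U)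
    (hstar : StarConvex ℝ (0 : V) U) (hg : IsPseudoRiemannianMetricOn g U)
    (hnormal : IsNormal g U) (hξ : ξ ∈ U) (h : IsTransportPair g ξ P S) {t : ℝ}
    (ht : t ∈ Icc (0 : ℝ) 1) :
    HasDerivWithinAt (fun t => P t * (1 + t • christoffel g (t • ξ) ξ))
      (-(transportedCurvature (g 0) g ξ S 0 t * t • P t)) (Icc 0 1) t := by
  have hd : DifferentiableAt ℝ (christoffel g) (t • ξ) :=
    ((contDiffOn_christoffel hU hg).contDiffAt
      (hU.mem_nhds (hstar.smul_mem hξ ht.1 ht.2))).differentiableAt (by simp)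
  have hΓ : HasDerivWithinAt (fun r : ℝ => christoffel g (r • ξ))
      (fderiv ℝ (christoffel g) (t • ξ) ξ) (Icc 0 1) t :=
    HasFDerivAt.comp_hasDerivWithinAt (l := christoffel g) (f := fun r : ℝ => r • ξ) t
      hd.hasFDerivAt (hasDerivWithinAt_smul_line ξ _ t)
  have hΓξ : HasDerivWithinAt (fun r : ℝ => christoffel g (r • ξ) ξ)
      (fderiv ℝ (christoffel g) (t • ξ) ξ ξ) (Icc 0 1) t := by
    simpa using hΓ.clm_apply (hasDerivWithinAt_const t _ ξ)
  have hsum : HasDerivWithinAt (fun r : ℝ => (1 : V →L[ℝ] V) + r • christoffel g (r • ξ) ξ)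
      (t • fderiv ℝ (christoffel g) (t • ξ) ξ ξ + christoffel g (t • ξ) ξ) (Icc 0 1) t := by
    simpa using ((hasDerivWithinAt_id t _).fun_smul hΓξ).const_add (1 : V →L[ℝ] V)
  refine ((h.hasDeriv_back t ht).fun_mul hsum).congr_deriv ?_
  ext v
  have hJ := congrArg (P t) (jacobi_radial hU h0 hstar hg hnormal hξ ht hd v)
  have hK := transportedCurvature_zero_mul_back hU h0 hstar hg hξ h ht v
  simp only [map_add, map_smul, map_neg] at hJ
  change P t (christoffel g (t • ξ) ξ (v + t • christoffel g (t • ξ) ξ v)) +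
    P t (t • fderiv ℝ (christoffel g) (t • ξ) ξ ξ v + christoffel g (t • ξ) ξ v) =
    -(transportedCurvature (g 0) g ξ S 0 t (t • P t v))
  rw [map_smul, hK, ← hJ]
  simp only [map_add, map_smul]
  module

end Transport

/-! ### Taylor expansion and uniform remainder estimate -/

section Expansion

variable {V : Type*} [NormedAddCommGroup V] [NormedSpace ℝ V] [FiniteDimensional ℝ V]
  {g : V → V →L[ℝ] V →L[ℝ] ℝ} {U : Set V}

/-- Taylor's inequality for the backwards parallel transport along a single line. -/
theorem norm_backwardsParallelTransport_sub_le (hU : IsOpen U) (h0 : (0 : V) ∈ U)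
    (hstar : StarConvex ℝ (0 : V) U) (hg : IsPseudoRiemannianMetricOn g U)
    (hnormal : IsNormal g U) {ξ : V} (hξ : ξ ∈ U) {P S : ℝ → V →L[ℝ] V}
    (h : IsTransportPair g ξ P S) (N : ℕ) {C : ℝ}
    (hC : ∀ t ∈ Icc (0 : ℝ) 1, ‖jacobiJet (fun j => transportedCurvature (g 0) g ξ S j t) (t • P t)
      (P t * (1 + t • christoffel g (t • ξ) ξ)) (N + 2)‖ ≤ C) :
    ‖backwardsParallelTransport g ξ - ∑ k ∈ Finset.range (N + 1), (1 / (k ! : ℝ)) •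
      substitute (symCurvatureOp (g 0) g) (Qtilde k) ξ‖ ≤ C := by
  let a : ℕ → ℝ → V →L[ℝ] V := fun n t =>
    jacobiJet (fun j => transportedCurvature (g 0) g ξ S j t) (t • P t)
      (P t * (1 + t • christoffel g (t • ξ) ξ)) n
  have ha : ∀ n, ∀ t ∈ Icc (0 : ℝ) 1, HasDerivWithinAt (a n) (a (n + 1) t) (Icc 0 1) t :=
    fun n t ht => hasDerivWithinAt_jacobiJet (𝔸 := V →L[ℝ] V)
      (K := transportedCurvature (g 0) g ξ S) (a₀ := fun t => t • P t)
      (a₁ := fun t => P t * (1 + t • christoffel g (t • ξ) ξ))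
      (fun j => hasDerivWithinAt_transportedCurvature _ hU hstar hg hnormal hξ h j ht)
      (hasDerivWithinAt_smul_back h ht)
      (hasDerivWithinAt_deriv_smul_back hU h0 hstar hg hnormal hξ h ht) n
  have hC' : ∀ t ∈ Icc (0 : ℝ) 1, ‖a (N + 1 + 1) t‖ ≤ C := hC
  have key : ‖a 0 1 - ∑ k ∈ Finset.range (N + 1 + 1), (1 / (k ! : ℝ)) • a k 0‖ ≤ C :=
    norm_sub_taylor_le_of_hasDerivWithinAt (E := V →L[ℝ] V) (a := a) ha hC'
  -- The Taylor term of order `0` is `0 • P 0 = 0`; dropping it shifts the index by one and leaves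
  -- `Q̃_k` at order `k + 1`.
  rw [Finset.sum_range_succ'] at key
  simp only [a, jacobiJet_zero, one_smul, zero_smul, smul_zero, add_zero, h.back_zero, mul_one,
    transportedCurvature_zero _ h.forth_zero, jacobiJet_succ_eq_lift_Qtilde] at key
  rw [h.backwardsParallelTransport_eq]
  convert key using 3
  refine Finset.sum_congr rfl fun k _ => ?_
  rw [substitute_apply, smul_smul]
  congr 1
  rw [Nat.factorial_succ]
  push_cast
  field_simp

theorem exists_eventually_norm_le {E F : Type*} [NormedAddCommGroup E] [NormedSpace ℝ E]
    [NormedAddCommGroup F] {f : E → F} (hf : ContinuousAt f 0) :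
    ∃ C : ℝ, ∀ᶠ ξ in 𝓝 (0 : E), ∀ t ∈ Icc (0 : ℝ) 1, ‖f (t • ξ)‖ ≤ C := by
  obtain ⟨r, hr, hball⟩ := Metric.eventually_nhds_iff_ball.mp
    (hf.norm.eventually (gt_mem_nhds (lt_add_one ‖f 0‖)))
  refine ⟨‖f 0‖ + 1, ?_⟩
  filter_upwards [Metric.ball_mem_nhds (0 : E) hr] with ξ hξ t ht
  refine (hball _ ?_).le
  rw [mem_ball_zero_iff] at hξ ⊢
  rw [norm_smul, Real.norm_of_nonneg ht.1]
  exact (mul_le_of_le_one_left (norm_nonneg _) ht.2).trans_lt hξ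

theorem isBigO_backwardsParallelTransport_sub (hU : IsOpen U) (h0 : (0 : V) ∈ U)
    (hstar : StarConvex ℝ (0 : V) U) (hg : IsPseudoRiemannianMetricOn g U)
    (hnormal : IsNormal g U) (N : ℕ) :
    (fun ξ : V => backwardsParallelTransport g ξ - ∑ k ∈ Finset.range (N + 1), (1 / (k ! : ℝ)) •
      substitute (symCurvatureOp (g 0) g) (Qtilde k) ξ) =O[𝓝 0] fun ξ : V => ‖ξ‖ ^ (N + 1) := by
  have hU0 := hU.mem_nhds h0
  obtain ⟨CΓ, hCΓ⟩ := exists_eventually_norm_le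
    ((contDiffOn_christoffel hU hg).continuousOn.continuousAt hU0)
  choose CR hCR using fun k => exists_eventually_norm_le
    ((contDiffOn_nablaCurvature hU hg k).continuousOn.continuousAt hU0)
  have hCR' : ∀ᶠ ξ in 𝓝 (0 : V), ∀ k ∈ Finset.range (N + 2), ∀ t ∈ Icc (0 : ℝ) 1,
      ‖nablaCurvature g k (t • ξ)‖ ≤ CR k :=
    (Filter.eventually_all_finset _).mpr fun k _ => hCR k
  let B : ℝ := ∑ k ∈ Finset.range (N + 2), |CR k|
  have hB : 0 ≤ B := Finset.sum_nonneg fun _ _ => abs_nonneg _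
  -- The first summand bounds the transported curvatures, where Gronwall gives `‖S t‖ ≤ e`; the
  -- second bounds both `t • P t` and its derivative `P t * (1 + t • Γ)`.
  let C : ℝ := ‖(g 0).inverse‖ * B * Real.exp 1 ^ 2 + Real.exp 1 * 2
  have hC0 : 0 ≤ ‖(g 0).inverse‖ * B * Real.exp 1 ^ 2 := by positivity
  have hC : 0 ≤ C := by positivity
  obtain ⟨D, hD, hjet⟩ := exists_norm_jacobiJet_le (𝔸 := V →L[ℝ] V) C hC (N + 2)
  -- The second condition gives the coefficient of the transport equation norm at most `1`, as the
  -- Gronwall bounds require.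
  have hsmall : ∀ᶠ ξ in 𝓝 (0 : V), ‖ξ‖ ≤ 1 ∧ CΓ * ‖ξ‖ ≤ 1 := by
    have h1 : Tendsto (fun ξ : V => ‖ξ‖) (𝓝 0) (𝓝 0) := tendsto_norm_zero
    have h2 : Tendsto (fun ξ : V => CΓ * ‖ξ‖) (𝓝 0) (𝓝 0) := by simpa using h1.const_mul CΓ
    exact (h1.eventually (ge_mem_nhds one_pos)).and (h2.eventually (ge_mem_nhds one_pos))
  refine IsBigO.of_bound D ?_
  filter_upwards [hU0, hCΓ, hCR', hsmall] with ξ hξ hΓ hR hs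
  obtain ⟨P, S, h⟩ := exists_isTransportPair hU hstar hg hξ
  have hG : ∀ t ∈ Icc (0 : ℝ) 1, ‖christoffel g (t • ξ) ξ‖ ≤ 1 := fun t ht =>
    ((christoffel g (t • ξ)).le_of_opNorm_le (hΓ t ht) ξ).trans hs.2
  rw [norm_pow, norm_norm]
  refine norm_backwardsParallelTransport_sub_le hU h0 hstar hg hnormal hξ h N fun t ht => ?_
  refine hjet ‖ξ‖ (fun j => transportedCurvature (g 0) g ξ S j t) (t • P t)
    (P t * (1 + t • christoffel g (t • ξ) ξ)) (norm_nonneg _) hs.1 (fun j hj => ?_) ?_ ?_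
    (N + 2) le_rfl
  · refine (norm_transportedCurvature_le _ j (h.norm_forth_le hG ht)).trans ?_
    refine mul_le_mul_of_nonneg_right ?_ (by positivity)
    have hRB : ‖nablaCurvature g j (t • ξ)‖ ≤ B :=
      (hR j (Finset.mem_range.mpr hj) t ht).trans ((le_abs_self _).trans
        (Finset.single_le_sum (f := fun k => |CR k|) (fun _ _ => abs_nonneg _)
          (Finset.mem_range.mpr hj)))
    have : ‖(g 0).inverse‖ * ‖nablaCurvature g j (t • ξ)‖ * Real.exp 1 ^ 2 ≤
        ‖(g 0).inverse‖ * B * Real.exp 1 ^ 2 := by gcongr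
    linarith [Real.exp_pos 1]
  · rw [norm_smul, Real.norm_of_nonneg ht.1]
    have := mul_le_of_le_one_left (norm_nonneg (P t)) ht.2
    linarith [h.norm_back_le hG ht, Real.exp_pos 1]
  · have h1 : ‖(1 : V →L[ℝ] V) + t • christoffel g (t • ξ) ξ‖ ≤ 2 := by
      refine (norm_add_le _ _).trans ?_
      rw [norm_smul, Real.norm_of_nonneg ht.1]
      have := mul_le_one₀ ht.2 (norm_nonneg _) (hG t ht)
      have : ‖(1 : V →L[ℝ] V)‖ ≤ 1 := ContinuousLinearMap.norm_id_le
      linarith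
    have := norm_mul_le_of_le (h.norm_back_le hG ht) h1
    linarith

end Expansion

end NormalCoord

end

theorem propositionp {V : Type*} [NormedAddCommGroup V] [NormedSpace ℝ V] [FiniteDimensional ℝ V]
    (b : V →L[ℝ] V →L[ℝ] ℝ) (hb : NormalCoord.IsPseudoEuclidean b)
    (U : Set V) (hU : IsOpen U) (h0 : (0 : V) ∈ U) (hstar : StarConvex ℝ (0 : V) U)
    (g : V → V →L[ℝ] V →L[ℝ] ℝ) (hg : NormalCoord.IsPseudoRiemannianMetricOn g U)
    (hg0 : g 0 = b) (hnormal : NormalCoord.IsNormal g U) :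
    (∀ ξ ∈ U, NormalCoord.IsBackwardsParallelTransport g ξ
        (NormalCoord.backwardsParallelTransport g ξ) ∧
      IsUnit (NormalCoord.backwardsParallelTransport g ξ)) ∧
    (∀ k : ℕ, NormalCoord.IsHomogeneousOfDegree k (NormalCoord.Qtilde k)) ∧
    ∀ N : ℕ, (fun ξ : V => NormalCoord.backwardsParallelTransport g ξ -
        ∑ k ∈ Finset.range (N + 1), (1 / (k ! : ℝ)) •
          NormalCoord.substitute (NormalCoord.symCurvatureOp b g) (NormalCoord.Qtilde k) ξ)
      =O[𝓝 0] fun ξ : V => ‖ξ‖ ^ (N + 1) := by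
  subst hg0
  refine ⟨fun ξ hξ => ?_, NormalCoord.isHomogeneousOfDegree_Qtilde,
    NormalCoord.isBigO_backwardsParallelTransport_sub hU h0 hstar hg hnormal⟩
  obtain ⟨P, S, h⟩ := NormalCoord.exists_isTransportPair hU hstar hg hξ
  rw [h.backwardsParallelTransport_eq]
  exact ⟨h.isBackwardsParallelTransport, h.isUnit_back_one⟩
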